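/- Let $S$ be the hyperbolic plane (curvature $K=-1$) or the open unit hemisphere (curvature $K=+1$), and put $Y(t)=\sinh t$ or $Y(t)=\sin t$ respectively. Let $\gamma$ be a simple closed convex curve of class $C^2$ on $S$ with length $P$ and geodesic curvature $k>0$, parametrized by arc length $x\in\mathbb R/P\mathbb Z$ with the enclosed domain on its left. Let $L(x,y)=\mathrm{dist}_S(\gamma(x),\gamma(y))$, with partial derivatives $L_1,L_2,L_{11},L_{12},L_{22}$ off the diagonal. A billiard configuration is a sequence $(x_n)_{n\in\mathbb Z}$ with $x_n\ne x_{n+1}$ and $L_2(x_{n-1},x_n)+L_1(x_n,x_{n+1})=0$ for all $n$. A Jacobi field along it is a real sequence $(\xi_n)$ with $$L_{12}(x_{n-1},x_n)\xi_{n-1}+\bigl(L_{22}(x_{n-1},x_n)+L_{11}(x_n,x_{n+1})\bigr)\xi_n+L_{12}(x_n,x_{n+1})\xi_{n+1}=0\quad\text{for all } n,$$ and $x_M,x_N$ ($M\neq N$) are conjugate if some non-zero Jacobi field vanishes at $M$ and $N$. Suppose that no billiard configuration has conjugate points. Then the relations $x\neq y$, $\Phi=-L_1(x,y)$, $\Psi=L_2(x,y)$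 define a bijection $T:(x,\Phi)\mapsto(y,\Psi)$ (the billiard map) of the phase cylinder $\Omega=\mathbb R/P\mathbb Z\times(-1,1)$. Write $\Phi=\cos\phi$ with $0<\phi<\pi$, $L(x,\Phi)=L(x,y)$ if $T(x,\Phi)=(y,\Psi)$, and $(x_n,\Phi_n)=T^n(x,\Phi)$, $\Phi_n=\cos\phi_n$. There is a measurable function $a:\Omega\to\mathbb R$ with $0<a(x,\Phi)<L(x,\Phi)$ on $\Omega$ such that for every $(x,\Phi)\in\Omega$ $$\frac{Y'}{Y}\bigl(a(x,\Phi)\bigr)+\frac{Y'}{Y}\bigl(L(x_{-1},\Phi_{-1})-a(x_{-1},\Phi_{-1})\bigr)=\frac{2k(x)}{\sin\phi}.$$ Moreover $a$ is the distance to the caustic point in the following sense: there is a measurable function $\nu:\Omega\to(0,\infty)$ such that along every orbit the sequences with $\xi_{n+1}=\nu(x_n,\Phi_n)\,\xi_n$ are Jacobi fields and such that, for every $(x,\Phi)\in\Omega$, there is a solution $J$ of $J''+KJ=0$ with $J(0)=\sin\phi$ and $J(L(x,\Phi))=-\nu(x,\Phi)\sin\phi_1$ (an orthogonal Jacobi field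 along the geodesic segment from $x$ to $x_1$) whose only zero in $[0,L(x,\Phi)]$ is $a(x,\Phi)$. -/

import Mathlib

noncomputable section

/-- The two model surfaces of constant curvature `-1` and `+1`. -/
inductive Model : Type
  | hyperbolic : Model
  | hemisphere : Model

namespace Model

/-- The Gauss curvature of the surface. -/
def curv : Model → ℝ
  | hyperbolic => -1
  | hemisphere => 1

/-- The ambient bilinear form on `ℝ³`: Lorentzian (signature `(+,+,-)`) for the hyperbolic plane,
Euclidean for the hemisphere. -/
def form (S : Model) (u v : Fin 3 → ℝ) : ℝ :=
  u 0 * v 0 + u 1 * v 1 + S.curv * (u 2 * v 2)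

/-- The surface: the upper sheet of the hyperboloid `u₀² + u₁² - u₂² = -1`, or the open upper half
of the unit sphere `u₀² + u₁² + u₂² = 1`. -/
def carrier (S : Model) : Set (Fin 3 → ℝ) :=
  {u | S.form u u = S.curv ∧ 0 < u 2}

/-- The geodesic distance between two points of the surface. -/
def geodDist : Model → (Fin 3 → ℝ) → (Fin 3 → ℝ) → ℝ
  | hyperbolic, u, v => Real.arcosh (-(hyperbolic.form u v))
  | hemisphere, u, v => Real.arccos (hemisphere.form u v)

/-- The Jacobi field `Y` along a unit-speed geodesic with `Y(0) = 0` and `Y'(0) = 1`. -/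
def Y : Model → ℝ → ℝ
  | hyperbolic => Real.sinh
  | hemisphere => Real.sin

/-- For `u` on the surface and `v` a unit tangent vector at `u`, the unit tangent vector at `u`
which is obtained from `v` by the rotation through `+π/2`; it is characterized by
`form w (leftNormal u v) = det (u, v, w)` for all `w`. -/
def leftNormal (S : Model) (u v : Fin 3 → ℝ) : Fin 3 → ℝ :=
  ![u 1 * v 2 - u 2 * v 1, u 2 * v 0 - u 0 * v 2, S.curv * (u 0 * v 1 - u 1 * v 0)]

/-- `J` is (the normal component of) an orthogonal Jacobi field along a unit-speed geodesic. -/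
def IsOrthogonalJacobiField (S : Model) (J : ℝ → ℝ) : Prop :=
  ContDiff ℝ 2 J ∧ ∀ t, deriv (deriv J) t + S.curv * J t = 0

end Model

/-- A convex billiard table on the surface `S`, given by its boundary: a simple closed convex curve
of class `C²` and of length `P`, parametrized by arc length (with the domain on its left), with
positive geodesic curvature. -/
structure ConvexBilliard (S : Model) where
  /-- The arc-length parametrization of the boundary, as a periodic function on the line. -/
  γ : ℝ → Fin 3 → ℝ
  /-- The perimeter. -/
  P : ℝ
  P_pos : 0 < P
  contDiff : ContDiff ℝ 2 γ
  mem_carrier : ∀ s, γ s ∈ S.carrier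
  periodic : Function.Periodic γ P
  simple : ∀ s t, γ s = γ t → (s : AddCircle P) = (t : AddCircle P)
  unit_speed : ∀ s, S.form (deriv γ s) (deriv γ s) = 1
  /-- The geodesic curvature with respect to the left normal is positive. -/
  curvature_pos : ∀ s, 0 < S.form (deriv (deriv γ) s) (S.leftNormal (γ s) (deriv γ s))
  /-- Convexity: the curve lies on one side (the left one) of each of its tangent geodesics. -/
  convex : ∀ s t, 0 ≤ S.form (γ t) (S.leftNormal (γ s) (deriv γ s))

namespace ConvexBilliard

variable {S : Model} (c : ConvexBilliard S)

/-- The geodesic curvature of the boundary. -/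
def k (s : ℝ) : ℝ := S.form (deriv (deriv c.γ) s) (S.leftNormal (c.γ s) (deriv c.γ s))

/-- The generating function: the distance between two boundary points. -/
def L (x y : ℝ) : ℝ := S.geodDist (c.γ x) (c.γ y)

/-- The partial derivative `∂L/∂x`. -/
def L₁ (x y : ℝ) : ℝ := deriv (fun t => c.L t y) x

/-- The partial derivative `∂L/∂y`. -/
def L₂ (x y : ℝ) : ℝ := deriv (fun t => c.L x t) y

/-- The partial derivative `∂²L/∂x²`. -/
def L₁₁ (x y : ℝ) : ℝ := deriv (fun t => c.L₁ t y) x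

/-- The partial derivative `∂²L/∂x∂y`. -/
def L₁₂ (x y : ℝ) : ℝ := deriv (fun t => c.L₁ x t) y

/-- The partial derivative `∂²L/∂y²`. -/
def L₂₂ (x y : ℝ) : ℝ := deriv (fun t => c.L₂ x t) y

/-- A billiard configuration: a sequence of boundary points (given by their arc-length parameters),
consecutive ones being distinct, which is an extremal of `∑ L(xₙ, xₙ₊₁)`. -/
def IsConfiguration (x : ℤ → ℝ) : Prop :=
  ∀ n, c.γ (x n) ≠ c.γ (x (n + 1)) ∧ c.L₂ (x (n - 1)) (x n) + c.L₁ (x n) (x (n + 1)) = 0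

/-- The discrete Jacobi equation along `x`. -/
def IsJacobiField (x ξ : ℤ → ℝ) : Prop :=
  ∀ n, c.L₁₂ (x (n - 1)) (x n) * ξ (n - 1)
    + (c.L₂₂ (x (n - 1)) (x n) + c.L₁₁ (x n) (x (n + 1))) * ξ n
    + c.L₁₂ (x n) (x (n + 1)) * ξ (n + 1) = 0

/-- The points `x_M` and `x_N` of the configuration are conjugate. -/
def AreConjugate (x : ℤ → ℝ) (M N : ℤ) : Prop :=
  ∃ ξ : ℤ → ℝ, c.IsJacobiField x ξ ∧ ξ ≠ 0 ∧ ξ M = 0 ∧ ξ N = 0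

/-- No billiard configuration has conjugate points. -/
def NoConjugatePoints : Prop :=
  ∀ x : ℤ → ℝ, c.IsConfiguration x → ∀ M N : ℤ, M ≠ N → ¬ c.AreConjugate x M N

/-- The phase cylinder `Ω = γ × (-1, 1)`, with coordinates `(x, Φ)`, `Φ = cos φ`. -/
abbrev Phase : Type := AddCircle c.P × Set.Ioo (-1 : ℝ) 1

/-- The boundary point with a given parameter modulo the perimeter. -/
def point : AddCircle c.P → Fin 3 → ℝ := c.periodic.lift

/-- `T` is the billiard ball map: `T (x, Φ) = (y, Ψ)` if and only if `Φ = -L₁(x, y)` and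
`Ψ = L₂(x, y)`, where `x ≠ y` on the boundary. -/
def IsBilliardMap (T : c.Phase ≃ c.Phase) : Prop :=
  ∀ (x y : ℝ) (Φ Ψ : Set.Ioo (-1 : ℝ) 1),
    T ((x : AddCircle c.P), Φ) = ((y : AddCircle c.P), Ψ) ↔
      c.γ x ≠ c.γ y ∧ (Φ : ℝ) = -c.L₁ x y ∧ (Ψ : ℝ) = c.L₂ x y

/-- The length `L(x, Φ)` of the segment that starts at the phase point `(x, Φ)`. -/
def segLength (T : c.Phase ≃ c.Phase) (p : c.Phase) : ℝ :=
  S.geodDist (c.point p.1) (c.point (T p).1)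

/-- `sin φ` at the phase point `(x, cos φ)`, where `0 < φ < π`. -/
def sinAngle (p : c.Phase) : ℝ := Real.sin (Real.arccos (p.2 : ℝ))

/-- `ν` is a measurable positive function on the phase cylinder whose cocycle satisfies the discrete
Jacobi equation: along every orbit `pₙ`, the sequences with `ξₙ₊₁ = ν(pₙ) ξₙ` are Jacobi fields. -/
def IsPositiveJacobiCocycle (T : c.Phase ≃ c.Phase) (ν : c.Phase → ℝ) : Prop :=
  Measurable ν ∧ (∀ p, 0 < ν p) ∧
    ∀ (p : ℤ → c.Phase) (x ξ : ℤ → ℝ), (∀ n, T (p n) = p (n + 1)) →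
      (∀ n, (x n : AddCircle c.P) = (p n).1) → (∀ n, ξ (n + 1) = ν (p n) * ξ n) →
      c.IsJacobiField x ξ

/-- `a` is the distance to the caustic point, along the segment that starts at a phase point `p`:
the caustic point is the only zero on the segment of the orthogonal Jacobi field `J` with boundary
values `sin φ₀` and `-ν sin φ₁`, where `ν` is a positive Jacobi cocycle. -/
def IsCausticDistance (T : c.Phase ≃ c.Phase) (a : c.Phase → ℝ) : Prop :=
  ∃ ν : c.Phase → ℝ, c.IsPositiveJacobiCocycle T ν ∧
    ∀ p, ∃ J : ℝ → ℝ, S.IsOrthogonalJacobiField J ∧ J 0 = c.sinAngle p ∧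
      J (c.segLength T p) = -(ν p * c.sinAngle (T p)) ∧
      ∀ t ∈ Set.Icc 0 (c.segLength T p), J t = 0 ↔ t = a p

end ConvexBilliard

end

/-! This is E. Hopf's argument for billiards. By strict convexity `L₁₂ > 0`, so the Jacobi equation
along an orbit is a three-term recursion `bₙ₋₁ ξₙ₋₁ - dₙ ξₙ + bₙ ξₙ₊₁ = 0` with `b > 0`. Let `rⱼ(p)`
be the ratio `ξ₁ / ξ₀` for the solution that vanishes at time `-(j + 1)`. The `rⱼ` obey a Riccati
recursion (`riccati`), and a zero of `rⱼ` would be a conjugate pair (`riccati_ne_zero`). Thus `rⱼ`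
is continuous and has no zeros on the connected universal cover of the phase cylinder, and it is
positive everywhere once it is positive on one orbit (`riccati_pos`). That orbit is the diameter,
where the second-order condition for the longest chord gives an explicit lower bound
(`exists_ratio_pos`).

The positive `rⱼ` decrease in `j` and stay above `b / (d ∘ T)`. Their limit `ν` is therefore
positive, measurable, and a solution of `b ν + (b / ν) ∘ T⁻¹ = d` (`exists_positive_cocycle`); this
equation says that `ν` is a positive Jacobi cocycle.

Geometry enters through `b = sin φ sin φ₁ / Y(L)` (`offCoeff_eq`) and `d = 2 k sin φ - sin² φ
(Y'/Y(L) + Y'/Y(L₋₁))` (`diagCoeff_eq`). The orthogonal Jacobi field with end values `sin φ` and `-ν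
sin φ₁` changes sign once, at distance `a`. The addition formula gives `Y'/Y(a) = (ν sin φ₁ / sin φ
+ Y'(L)) / Y(L)`, and symmetrically from the other end (`dY_div_Y_focus`). Division of the equation
for `ν` by `sin² φ` then turns it into the mirror equation. -/

noncomputable section

/-! ### The ambient form, moving frames and trigonometry of the model surfaces. -/

namespace Model

lemma curv_mul_self (S : Model) : S.curv * S.curv = 1 := by cases S <;> simp [curv]

lemma form_comm (S : Model) (u v : Fin 3 → ℝ) : S.form u v = S.form v u := by
  unfold form; ring

/-- The product of two determinants as a Gram determinant. -/
lemma form_leftNormal_mul (S : Model) (a b c d e f : Fin 3 → ℝ) :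
    S.form c (S.leftNormal a b) * S.form f (S.leftNormal d e) =
      S.curv * (S.form a d * (S.form b e * S.form c f - S.form b f * S.form c e)
        - S.form a e * (S.form b d * S.form c f - S.form b f * S.form c d)
        + S.form a f * (S.form b d * S.form c e - S.form b e * S.form c d)) := by
  cases S <;> simp [form, leftNormal, curv] <;> ring

lemma form_leftNormal_left (S : Model) (u v : Fin 3 → ℝ) : S.form u (S.leftNormal u v) = 0 := by
  cases S <;> simp [form, leftNormal, curv] <;> ring

lemma form_leftNormal_right (S : Model) (u v : Fin 3 → ℝ) : S.form v (S.leftNormal u v) = 0 := by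
  cases S <;> simp [form, leftNormal, curv] <;> ring

lemma form_leftNormal_leftNormal (S : Model) (a b d e : Fin 3 → ℝ) :
    S.form (S.leftNormal a b) (S.leftNormal d e) =
      S.curv * (S.form a d * S.form b e - S.form a e * S.form b d) := by
  cases S <;> simp [form, leftNormal, curv] <;> ring

section Frame

variable {S : Model} {u v : Fin 3 → ℝ}

/-- The expansion of the form in the orthonormal frame `u, v, leftNormal u v`. -/
lemma form_eq_frame (huu : S.form u u = S.curv) (hvv : S.form v v = 1) (huv : S.form u v = 0)
    (w z : Fin 3 → ℝ) :
    S.form w z = S.curv * (S.form w u * S.form z u) + S.form w v * S.form z v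
      + S.form w (S.leftNormal u v) * S.form z (S.leftNormal u v) := by
  have h := S.form_leftNormal_mul u v w u v z
  rw [S.form_comm v u, huu, hvv, huv] at h
  rw [h, S.form_comm u z, S.form_comm v z]
  linear_combination (-(S.form w z) + S.form w v * S.form z v) * S.curv_mul_self

lemma form_leftNormal_self (huu : S.form u u = S.curv) (hvv : S.form v v = 1)
    (huv : S.form u v = 0) : S.form (S.leftNormal u v) (S.leftNormal u v) = 1 := by
  rw [form_leftNormal_leftNormal, S.form_comm v u, huu, hvv, huv]
  linear_combination S.curv_mul_self

lemma form_leftNormal_eq (huu : S.form u u = S.curv) (hvv : S.form v v = 1) (huv : S.form u v = 0)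
    (w z : Fin 3 → ℝ) :
    S.form z (S.leftNormal u w) = S.form w v * S.form z (S.leftNormal u v)
      - S.form w (S.leftNormal u v) * S.form z v := by
  have h := S.form_leftNormal_mul u w z u v (S.leftNormal u v)
  rw [form_leftNormal_self huu hvv huv, huu, huv, form_leftNormal_left] at h
  linear_combination h + (S.form w v * S.form z (S.leftNormal u v)
    - S.form w (S.leftNormal u v) * S.form z v) * S.curv_mul_self

end Frame

lemma hasDerivAt_form (S : Model) {u v : ℝ → Fin 3 → ℝ} {u' v' : Fin 3 → ℝ} {t : ℝ}
    (hu : HasDerivAt u u' t) (hv : HasDerivAt v v' t) :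
    HasDerivAt (fun s => S.form (u s) (v s)) (S.form u' (v t) + S.form (u t) v') t := by
  rw [hasDerivAt_pi] at hu hv
  refine ((((hu 0).mul (hv 0)).add ((hu 1).mul (hv 1))).add
    (((hu 2).mul (hv 2)).const_mul S.curv)).congr_deriv ?_
  unfold form; ring

lemma hasDerivAt_leftNormal (S : Model) {u v : ℝ → Fin 3 → ℝ} {u' v' : Fin 3 → ℝ} {t : ℝ}
    (hu : HasDerivAt u u' t) (hv : HasDerivAt v v' t) :
    HasDerivAt (fun s => S.leftNormal (u s) (v s))
      (S.leftNormal u' (v t) + S.leftNormal (u t) v') t := by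
  rw [hasDerivAt_pi] at hu hv ⊢
  intro i
  fin_cases i
  · refine (((hu 1).mul (hv 2)).sub ((hu 2).mul (hv 1))).congr_deriv ?_
    simp [leftNormal]; ring
  · refine (((hu 2).mul (hv 0)).sub ((hu 0).mul (hv 2))).congr_deriv ?_
    simp [leftNormal]; ring
  · refine ((((hu 0).mul (hv 1)).sub ((hu 1).mul (hv 0))).const_mul S.curv).congr_deriv ?_
    simp [leftNormal]; ring

lemma leftNormal_self (S : Model) (v : Fin 3 → ℝ) : S.leftNormal v v = 0 := by
  ext i; fin_cases i <;> simp [leftNormal] <;> ring_nf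
  simp

lemma continuous_form (S : Model) {X : Type*} [TopologicalSpace X] {u v : X → Fin 3 → ℝ}
    (hu : Continuous u) (hv : Continuous v) : Continuous fun s => S.form (u s) (v s) := by
  unfold form; fun_prop

lemma continuous_leftNormal (S : Model) {X : Type*} [TopologicalSpace X] {u v : X → Fin 3 → ℝ}
    (hu : Continuous u) (hv : Continuous v) : Continuous fun s => S.leftNormal (u s) (v s) := by
  refine continuous_pi fun i => ?_
  fin_cases i <;> simp [leftNormal] <;> fun_prop

/-- The derivative of `Y`. -/
def dY : Model → ℝ → ℝ
  | hyperbolic => Real.cosh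
  | hemisphere => Real.cos

lemma hasDerivAt_Y (S : Model) (t : ℝ) : HasDerivAt S.Y (S.dY t) t := by
  cases S
  · exact Real.hasDerivAt_sinh t
  · exact Real.hasDerivAt_sin t

lemma hasDerivAt_dY (S : Model) (t : ℝ) : HasDerivAt S.dY (-(S.curv * S.Y t)) t := by
  cases S
  · exact (Real.hasDerivAt_cosh t).congr_deriv (by simp [curv, Y])
  · exact (Real.hasDerivAt_cos t).congr_deriv (by simp [curv, Y])

lemma deriv_Y (S : Model) : deriv S.Y = S.dY := funext fun t => (S.hasDerivAt_Y t).deriv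

lemma Y_zero (S : Model) : S.Y 0 = 0 := by cases S <;> simp [Y]

lemma Y_sub (S : Model) (s t : ℝ) : S.Y (s - t) = S.Y s * S.dY t - S.dY s * S.Y t := by
  cases S
  · exact Real.sinh_sub s t
  · exact Real.sin_sub s t

lemma dY_sq (S : Model) (t : ℝ) : S.dY t ^ 2 + S.curv * S.Y t ^ 2 = 1 := by
  cases S
  · have := Real.cosh_sq t
    simp only [Y, dY, curv]; linarith
  · have := Real.sin_sq_add_cos_sq t
    simp only [Y, dY, curv]; linarith

/-- The distance of two points as a function of the value of the form on them. -/
def distOfForm : Model → ℝ → ℝ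
  | hyperbolic, r => Real.arcosh (-r)
  | hemisphere, r => Real.arccos r

/-- The values of the form on pairs of distinct points of the surface. -/
def offDiag : Model → Set ℝ
  | hyperbolic => Set.Iio (-1)
  | hemisphere => Set.Ioo (-1) 1

lemma geodDist_eq (S : Model) (u v : Fin 3 → ℝ) : S.geodDist u v = S.distOfForm (S.form u v) := by
  cases S <;> rfl

lemma lt_curv_of_mem_offDiag {S : Model} {r : ℝ} (hr : r ∈ S.offDiag) : r < S.curv := by
  cases S
  · exact hr
  · exact hr.2

/-- On the hyperboloid this is the strict reversed Cauchy–Schwarz inequality, from Lagrange's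
identity. On the sphere, expand `|u - v|² > 0` and `|u + v|² > 0`; the latter holds because
antipodes are not both in the open upper half. -/
lemma form_mem_offDiag {S : Model} {u v : Fin 3 → ℝ} (hu : u ∈ S.carrier) (hv : v ∈ S.carrier)
    (h : u ≠ v) : S.form u v ∈ S.offDiag := by
  obtain ⟨hu1, hu2⟩ := hu
  obtain ⟨hv1, hv2⟩ := hv
  cases S
  · simp only [form, curv, offDiag, Set.mem_Iio] at *
    have hne : u 0 - v 0 ≠ 0 ∨ u 1 - v 1 ≠ 0 := by
      by_contra! hc
      refine h (funext fun i => ?_)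
      have h0 : u 0 = v 0 := by linarith [hc.1]
      have h1 : u 1 = v 1 := by linarith [hc.2]
      fin_cases i
      · exact h0
      · exact h1
      · have h2 : u 2 ^ 2 = v 2 ^ 2 := by rw [h0, h1] at hu1; linarith
        exact (pow_left_inj₀ hu2.le hv2.le two_ne_zero).1 h2
    have hpos : 0 < (u 0 - v 0) ^ 2 + (u 1 - v 1) ^ 2 := by
      rcases hne with h | h <;> positivity
    have hsq : (1 + u 0 * v 0 + u 1 * v 1) ^ 2 < (u 2 * v 2) ^ 2 := by
      have e1 : u 2 ^ 2 = 1 + u 0 ^ 2 + u 1 ^ 2 := by linarith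
      have e2 : v 2 ^ 2 = 1 + v 0 ^ 2 + v 1 ^ 2 := by linarith
      rw [mul_pow, e1, e2]
      nlinarith [sq_nonneg (u 0 * v 1 - u 1 * v 0)]
    have := lt_of_pow_lt_pow_left₀ 2 (by positivity) hsq
    linarith
  · simp only [form, curv, offDiag, Set.mem_Ioo] at *
    have hne : 0 < (u 0 - v 0) ^ 2 + (u 1 - v 1) ^ 2 + (u 2 - v 2) ^ 2 := by
      by_contra! hc
      refine h (funext fun i => ?_)
      have h0 := sq_nonneg (u 0 - v 0)
      have h1 := sq_nonneg (u 1 - v 1)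
      have h2 := sq_nonneg (u 2 - v 2)
      fin_cases i
      · exact sub_eq_zero.1 (pow_eq_zero_iff two_ne_zero |>.1
          (show (u 0 - v 0) ^ 2 = 0 by linarith))
      · exact sub_eq_zero.1 (pow_eq_zero_iff two_ne_zero |>.1
          (show (u 1 - v 1) ^ 2 = 0 by linarith))
      · exact sub_eq_zero.1 (pow_eq_zero_iff two_ne_zero |>.1
          (show (u 2 - v 2) ^ 2 = 0 by linarith))
    have hp : 0 < (u 2 + v 2) ^ 2 := by positivity
    constructor
    · nlinarith [sq_nonneg (u 0 + v 0), sq_nonneg (u 1 + v 1)]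
    · nlinarith

section OffDiag

variable {S : Model} {r : ℝ}

lemma distOfForm_pos (hr : r ∈ S.offDiag) : 0 < S.distOfForm r := by
  cases S
  · exact Real.arcosh_pos (by simp only [offDiag, Set.mem_Iio] at hr; linarith)
  · exact Real.arccos_pos.2 hr.2

lemma Y_pos_of_le_distOfForm (hr : r ∈ S.offDiag)
    {t : ℝ} (ht : 0 < t) (ht' : t ≤ S.distOfForm r) : 0 < S.Y t := by
  cases S
  · exact Real.sinh_pos_iff.2 ht
  · have hlt : Real.arccos r < Real.pi :=
      lt_of_le_of_ne (Real.arccos_le_pi r) fun h => by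
        rw [Real.arccos_eq_pi] at h; exact absurd hr.1 (not_lt.2 h)
    exact Real.sin_pos_of_pos_of_lt_pi ht (lt_of_le_of_lt ht' hlt)

lemma Y_distOfForm_pos (hr : r ∈ S.offDiag) : 0 < S.Y (S.distOfForm r) :=
  Y_pos_of_le_distOfForm hr (distOfForm_pos hr) le_rfl

lemma dY_distOfForm (hr : r ∈ S.offDiag) : S.dY (S.distOfForm r) = S.curv * r := by
  cases S
  · simp only [offDiag, Set.mem_Iio] at hr
    simp only [dY, distOfForm, curv]
    rw [Real.cosh_arcosh (by linarith)]; ring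
  · simp only [dY, distOfForm, curv]
    rw [Real.cos_arccos hr.1.le hr.2.le]; ring

lemma Y_distOfForm_sq (hr : r ∈ S.offDiag) :
    S.Y (S.distOfForm r) ^ 2 = S.curv - S.curv * r ^ 2 := by
  have h := S.dY_sq (S.distOfForm r)
  rw [dY_distOfForm hr] at h
  linear_combination S.curv * h - (S.Y (S.distOfForm r) ^ 2 + S.curv * r ^ 2) * S.curv_mul_self

lemma hasDerivAt_distOfForm (hr : r ∈ S.offDiag) :
    HasDerivAt S.distOfForm (-(S.Y (S.distOfForm r))⁻¹) r := by
  cases S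
  · simp only [offDiag, Set.mem_Iio] at hr
    have h := (Real.hasDerivAt_arcosh (x := -r) (by simp; linarith)).comp r (hasDerivAt_neg r)
    refine h.congr_deriv ?_
    simp only [Y, distOfForm]
    rw [Real.sinh_arcosh (by linarith)]
    simp
  · refine (Real.hasDerivAt_arccos hr.1.ne' hr.2.ne).congr_deriv ?_
    simp only [Y, distOfForm]
    rw [Real.sin_arccos]
    simp

end OffDiag

end Model

/-! ### First and second derivatives of the chord length. -/

namespace ConvexBilliard

variable {S : Model} (c : ConvexBilliard S)

/-- The value of the ambient form on two boundary points. -/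
def pairing (x y : ℝ) : ℝ := S.form (c.γ x) (c.γ y)

/-- The component of `γ y` along the tangent at `x`. -/
def tang (x y : ℝ) : ℝ := S.form (deriv c.γ x) (c.γ y)

/-- The component of `γ y` along the inner normal at `x`. -/
def nor (x y : ℝ) : ℝ := S.form (c.γ y) (S.leftNormal (c.γ x) (deriv c.γ x))

/-- The value `Y (L(x, y))`. -/
def chord (x y : ℝ) : ℝ := S.Y (c.L x y)

lemma hasDerivAt_γ (x : ℝ) : HasDerivAt c.γ (deriv c.γ x) x :=
  ((c.contDiff.differentiable (by norm_num)) x).hasDerivAt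

lemma contDiff_deriv : ContDiff ℝ 1 (deriv c.γ) :=
  (contDiff_succ_iff_deriv (n := 1).1 c.contDiff).2.2

lemma hasDerivAt_deriv_γ (x : ℝ) : HasDerivAt (deriv c.γ) (deriv (deriv c.γ) x) x :=
  ((c.contDiff_deriv.differentiable (by norm_num)) x).hasDerivAt

lemma continuous_γ : Continuous c.γ := c.contDiff.continuous

lemma continuous_deriv_γ : Continuous (deriv c.γ) := c.contDiff_deriv.continuous

lemma continuous_deriv_deriv_γ : Continuous (deriv (deriv c.γ)) :=
  c.contDiff_deriv.continuous_deriv le_rfl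

lemma continuous_k : Continuous c.k :=
  S.continuous_form c.continuous_deriv_deriv_γ
    (S.continuous_leftNormal c.continuous_γ c.continuous_deriv_γ)

lemma continuous_tang : Continuous fun p : ℝ × ℝ => c.tang p.1 p.2 :=
  S.continuous_form (c.continuous_deriv_γ.comp continuous_fst) (c.continuous_γ.comp continuous_snd)

lemma continuous_nor : Continuous fun p : ℝ × ℝ => c.nor p.1 p.2 :=
  S.continuous_form (c.continuous_γ.comp continuous_snd)
    (S.continuous_leftNormal (c.continuous_γ.comp continuous_fst)
      (c.continuous_deriv_γ.comp continuous_fst))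

lemma continuous_pairing : Continuous fun p : ℝ × ℝ => c.pairing p.1 p.2 :=
  S.continuous_form (c.continuous_γ.comp continuous_fst) (c.continuous_γ.comp continuous_snd)

lemma form_γ_γ (x : ℝ) : S.form (c.γ x) (c.γ x) = S.curv := (c.mem_carrier x).1

lemma form_γ_deriv (x : ℝ) : S.form (c.γ x) (deriv c.γ x) = 0 := by
  have h := S.hasDerivAt_form (c.hasDerivAt_γ x) (c.hasDerivAt_γ x)
  have h' := h.unique ((hasDerivAt_const x S.curv).congr_of_eventuallyEq
    (Filter.Eventually.of_forall c.form_γ_γ))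
  rw [S.form_comm (deriv c.γ x)] at h'
  linarith

lemma form_deriv_deriv_γ_deriv (x : ℝ) : S.form (deriv (deriv c.γ) x) (deriv c.γ x) = 0 := by
  have h := S.hasDerivAt_form (c.hasDerivAt_deriv_γ x) (c.hasDerivAt_deriv_γ x)
  have h' := h.unique ((hasDerivAt_const x (1 : ℝ)).congr_of_eventuallyEq
    (Filter.Eventually.of_forall c.unit_speed))
  rw [S.form_comm (deriv c.γ x)] at h'
  linarith

lemma form_deriv_deriv_γ_γ (x : ℝ) : S.form (deriv (deriv c.γ) x) (c.γ x) = -1 := by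
  have h := S.hasDerivAt_form (c.hasDerivAt_γ x) (c.hasDerivAt_deriv_γ x)
  have h' := h.unique ((hasDerivAt_const x (0 : ℝ)).congr_of_eventuallyEq
    (Filter.Eventually.of_forall c.form_γ_deriv))
  rw [S.form_comm (c.γ x), c.unit_speed x] at h'
  linarith

lemma form_eq_frame (x : ℝ) (w z : Fin 3 → ℝ) :
    S.form w z = S.curv * (S.form w (c.γ x) * S.form z (c.γ x))
      + S.form w (deriv c.γ x) * S.form z (deriv c.γ x)
      + S.form w (S.leftNormal (c.γ x) (deriv c.γ x))
        * S.form z (S.leftNormal (c.γ x) (deriv c.γ x)) :=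
  Model.form_eq_frame (c.form_γ_γ x) (c.unit_speed x) (c.form_γ_deriv x) w z

/-- The geodesic curvature equation `γ'' = -K γ + k n`, paired with a boundary point. -/
lemma form_deriv_deriv (x y : ℝ) :
    S.form (deriv (deriv c.γ) x) (c.γ y) = -(S.curv * c.pairing x y) + c.k x * c.nor x y := by
  rw [c.form_eq_frame x, form_deriv_deriv_γ_γ, form_deriv_deriv_γ_deriv]
  rw [S.form_comm (c.γ y) (c.γ x)]
  simp only [pairing, k, nor]; ring

lemma tang_sq_add_nor_sq (x y : ℝ) :
    c.tang x y ^ 2 + c.nor x y ^ 2 = S.curv - S.curv * c.pairing x y ^ 2 := by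
  have h := c.form_eq_frame x (c.γ y) (c.γ y)
  rw [c.form_γ_γ y, S.form_comm (c.γ y) (c.γ x), S.form_comm (c.γ y) (deriv c.γ x)] at h
  simp only [tang, nor, pairing]
  linear_combination -h

lemma pairing_comm (x y : ℝ) : c.pairing x y = c.pairing y x := S.form_comm _ _

lemma L_comm (x y : ℝ) : c.L x y = c.L y x := by
  simp only [L, Model.geodDist_eq, S.form_comm]

lemma chord_comm (x y : ℝ) : c.chord x y = c.chord y x := by rw [chord, L_comm]; rfl

/-- The Frenet equation `n' = -k γ'` for the inner normal, paired with `γ y`. -/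
lemma hasDerivAt_nor_left (x y : ℝ) :
    HasDerivAt (fun t => c.nor t y) (-(c.k x * c.tang x y)) x := by
  have h := S.hasDerivAt_form (hasDerivAt_const x (c.γ y))
    (S.hasDerivAt_leftNormal (c.hasDerivAt_γ x) (c.hasDerivAt_deriv_γ x))
  refine h.congr_deriv ?_
  have e := Model.form_leftNormal_eq (c.form_γ_γ x) (c.unit_speed x) (c.form_γ_deriv x)
    (deriv (deriv c.γ) x) (c.γ y)
  rw [form_deriv_deriv_γ_deriv, S.form_comm (c.γ y) (deriv c.γ x)] at e
  rw [S.leftNormal_self, zero_add, e, k, tang]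
  simp [Model.form]

lemma hasDerivAt_nor_right (x y : ℝ) :
    HasDerivAt (fun t => c.nor x t)
      (S.form (deriv c.γ y) (S.leftNormal (c.γ x) (deriv c.γ x))) y := by
  refine (S.hasDerivAt_form (c.hasDerivAt_γ y) (hasDerivAt_const y _)).congr_deriv ?_
  simp [Model.form]

lemma hasDerivAt_tang_left (x y : ℝ) :
    HasDerivAt (fun t => c.tang t y) (S.form (deriv (deriv c.γ) x) (c.γ y)) x := by
  refine (S.hasDerivAt_form (c.hasDerivAt_deriv_γ x) (hasDerivAt_const x _)).congr_deriv ?_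
  simp [Model.form]

lemma hasDerivAt_tang_right (x y : ℝ) :
    HasDerivAt (fun t => c.tang x t) (S.form (deriv c.γ x) (deriv c.γ y)) y := by
  refine (S.hasDerivAt_form (hasDerivAt_const y _) (c.hasDerivAt_γ y)).congr_deriv ?_
  simp [Model.form]

lemma hasDerivAt_pairing_left (x y : ℝ) :
    HasDerivAt (fun t => c.pairing t y) (c.tang x y) x := by
  refine (S.hasDerivAt_form (c.hasDerivAt_γ x) (hasDerivAt_const x _)).congr_deriv ?_
  simp [Model.form, tang]

section Distinct

variable {c} {x y : ℝ}

lemma pairing_mem_offDiag (h : c.γ x ≠ c.γ y) : c.pairing x y ∈ S.offDiag :=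
  Model.form_mem_offDiag (c.mem_carrier x) (c.mem_carrier y) h

lemma chord_pos (h : c.γ x ≠ c.γ y) : 0 < c.chord x y := by
  rw [chord, L, Model.geodDist_eq]
  exact Model.Y_distOfForm_pos (pairing_mem_offDiag h)

lemma L_pos (h : c.γ x ≠ c.γ y) : 0 < c.L x y := by
  rw [L, Model.geodDist_eq]
  exact Model.distOfForm_pos (pairing_mem_offDiag h)

lemma Y_pos_of_le_L (h : c.γ x ≠ c.γ y) {t : ℝ} (ht : 0 < t) (ht' : t ≤ c.L x y) : 0 < S.Y t := by
  rw [L, Model.geodDist_eq] at ht'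
  exact Model.Y_pos_of_le_distOfForm (pairing_mem_offDiag h) ht ht'

/-- Because of this, `tang / chord` and `nor / chord` are the cosine and the sine of the angle
between the boundary and the chord. -/
lemma chord_sq (h : c.γ x ≠ c.γ y) : c.chord x y ^ 2 = c.tang x y ^ 2 + c.nor x y ^ 2 := by
  rw [tang_sq_add_nor_sq, chord, L, Model.geodDist_eq]
  exact Model.Y_distOfForm_sq (pairing_mem_offDiag h)

lemma dY_L (h : c.γ x ≠ c.γ y) : S.dY (c.L x y) = S.curv * c.pairing x y := by
  rw [L, Model.geodDist_eq]
  exact Model.dY_distOfForm (pairing_mem_offDiag h)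

/-- Strict convexity of the boundary. -/
lemma nor_pos (h : c.γ x ≠ c.γ y) : 0 < c.nor x y := by
  refine lt_of_le_of_ne (c.convex x y) fun h0 => ?_
  -- By convexity a zero of `nor · y` is a minimum, so its derivative `-k · tang` vanishes there.
  -- Then `tang` and `nor` are both zero, and so is the chord.
  have hmin : IsLocalMin (fun t => c.nor t y) x :=
    Filter.Eventually.of_forall fun t => h0.symm.le.trans (c.convex t y)
  have hd := hmin.hasDerivAt_eq_zero (c.hasDerivAt_nor_left x y)
  have ht : c.tang x y = 0 := by
    have hk : c.k x ≠ 0 := (c.curvature_pos x).ne'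
    simpa [hk] using hd
  have := chord_sq h
  rw [ht, show c.nor x y = 0 from h0.symm] at this
  exact (chord_pos h).ne' (by simpa using this)

lemma hasDerivAt_L_left (h : c.γ x ≠ c.γ y) :
    HasDerivAt (fun t => c.L t y) (-(c.tang x y / c.chord x y)) x := by
  have h1 := (Model.hasDerivAt_distOfForm (pairing_mem_offDiag h)).comp x
    (c.hasDerivAt_pairing_left x y)
  have e : (fun t => c.L t y) = S.distOfForm ∘ fun t => c.pairing t y :=
    funext fun t => S.geodDist_eq _ _
  rw [e]
  refine h1.congr_deriv ?_
  rw [chord, L, Model.geodDist_eq]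
  change _ = -(_ / S.Y (S.distOfForm (c.pairing x y)))
  ring

lemma L₁_eq (h : c.γ x ≠ c.γ y) :
    c.L₁ x y = -(c.tang x y / c.chord x y) := (hasDerivAt_L_left h).deriv

lemma eventually_γ_ne_left (h : c.γ x ≠ c.γ y) : ∀ᶠ t in nhds x, c.γ t ≠ c.γ y :=
  c.continuous_γ.continuousAt.eventually_ne h

lemma hasDerivAt_chord_left (h : c.γ x ≠ c.γ y) :
    HasDerivAt (fun t => c.chord t y)
      (-(S.curv * c.pairing x y * (c.tang x y / c.chord x y))) x := by
  refine ((S.hasDerivAt_Y (c.L x y)).comp x (hasDerivAt_L_left h)).congr_deriv ?_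
  rw [dY_L h]; ring

/-- With `nor / chord = sin φ` the right side is `sin² φ · Y'/Y(L) - k sin φ`. The second term comes
from the curvature equation for `γ''`. -/
lemma L₁₁_eq (h : c.γ x ≠ c.γ y) : c.L₁₁ x y =
    (c.nor x y / c.chord x y) ^ 2 * (S.dY (c.L x y) / S.Y (c.L x y))
      - c.k x * (c.nor x y / c.chord x y) := by
  have hW := (chord_pos h).ne'
  have h1 := ((c.hasDerivAt_tang_left x y).div (hasDerivAt_chord_left h) hW).neg
  have h2 : (fun t => c.L₁ t y) =ᶠ[nhds x] fun t => -(c.tang t y / c.chord t y) := by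
    filter_upwards [eventually_γ_ne_left h] with t ht using L₁_eq ht
  rw [L₁₁, h2.deriv_eq]
  refine h1.deriv.trans ?_
  change _ = (c.nor x y / c.chord x y) ^ 2 * (S.dY (c.L x y) / c.chord x y) - _
  rw [c.form_deriv_deriv, dY_L h]
  have hs := chord_sq h
  field_simp
  linear_combination (S.curv * c.pairing x y) * hs

end Distinct

lemma L₂_eq_L₁ (x y : ℝ) : c.L₂ x y = c.L₁ y x := by
  simp only [L₂, L₁, c.L_comm x]

lemma L₂₂_eq_L₁₁ (x y : ℝ) : c.L₂₂ x y = c.L₁₁ y x := by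
  simp only [L₂₂, L₁₁, L₂_eq_L₁]

/-- A product of two determinants is a Gram determinant. This form expresses the product of the two
sines by the quantities that occur in the mixed derivative of the distance. -/
lemma nor_mul_nor (x y : ℝ) :
    c.nor x y * c.nor y x = -(S.form (deriv c.γ x) (deriv c.γ y)
      * (S.curv - S.curv * c.pairing x y ^ 2)
      + S.curv * c.pairing x y * (c.tang x y * c.tang y x)) := by
  have h := S.form_leftNormal_mul (c.γ x) (deriv c.γ x) (c.γ y) (c.γ y) (deriv c.γ y) (c.γ x)
  rw [c.form_γ_γ x, S.form_comm (deriv c.γ x) (c.γ x), c.form_γ_deriv x, c.form_γ_γ y,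
    c.form_γ_deriv y, S.form_comm (c.γ y) (c.γ x), S.form_comm (c.γ x) (deriv c.γ y)] at h
  simp only [nor, pairing, tang]
  rw [h]
  linear_combination (-(S.curv * S.form (deriv c.γ x) (deriv c.γ y))) * S.curv_mul_self

section Distinct

variable {c} {x y : ℝ}

lemma hasDerivAt_tang_div_chord (h : c.γ x ≠ c.γ y) :
    HasDerivAt (fun t => c.tang x t / c.chord x t)
      (-(c.nor x y * c.nor y x / c.chord x y ^ 3)) y := by
  have hW := (chord_pos h).ne'
  have hc : HasDerivAt (fun t => c.chord x t)
      (-(S.curv * c.pairing x y * (c.tang y x / c.chord x y))) y := by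
    have := hasDerivAt_chord_left h.symm
    simpa only [c.chord_comm _ x, c.pairing_comm y x] using this
  refine ((c.hasDerivAt_tang_right x y).div hc hW).congr_deriv ?_
  have hs := chord_sq h
  rw [tang_sq_add_nor_sq] at hs
  rw [nor_mul_nor, ← hs]
  field_simp
  ring

lemma L₁₂_eq (h : c.γ x ≠ c.γ y) : c.L₁₂ x y = c.nor x y * c.nor y x / c.chord x y ^ 3 := by
  have h2 : (fun t => c.L₁ x t) =ᶠ[nhds y] fun t => -(c.tang x t / c.chord x t) := by
    filter_upwards [eventually_γ_ne_left h.symm] with t ht using L₁_eq ht.symm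
  rw [L₁₂, h2.deriv_eq]
  exact (hasDerivAt_tang_div_chord h).neg.deriv.trans (neg_neg _)

end Distinct

end ConvexBilliard

/-! ### Hopf's limit of Riccati iterates for an abstract second-order recursion. -/

section Riccati

open Filter Topology

/-- The second order linear recursion `bₙ₋₁ ξₙ₋₁ - dₙ ξₙ + bₙ ξₙ₊₁ = 0`, as a bijection of the
extended phase space. -/
def jacobiStep (d b : ℤ → ℝ) (hb : ∀ n, b n ≠ 0) : Equiv.Perm (ℤ × ℝ × ℝ) where
  toFun z := (z.1 + 1, z.2.2, (d (z.1 + 1) * z.2.2 - b z.1 * z.2.1) / b (z.1 + 1))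
  invFun z := (z.1 - 1, (d z.1 * z.2.1 - b z.1 * z.2.2) / b (z.1 - 1), z.2.1)
  left_inv := by
    rintro ⟨n, u, v⟩
    have h1 := hb n
    have h2 := hb (n + 1)
    simp only [add_sub_cancel_right, Prod.mk.injEq, true_and, and_true]
    field_simp
    ring
  right_inv := by
    rintro ⟨n, u, v⟩
    have h1 := hb (n - 1)
    have h2 := hb n
    simp only [sub_add_cancel, Prod.mk.injEq, true_and]
    field_simp
    ring

/-- The two-sided solution is read off the integer powers of `jacobiStep`. Its state is `(n, ξₙ,
ξₙ₊₁)`; carrying the time `n` makes the recursion autonomous. -/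
lemma exists_jacobi_sequence (d b : ℤ → ℝ) (hb : ∀ n, b n ≠ 0) (M : ℤ) :
    ∃ ξ : ℤ → ℝ, (∀ n, b (n - 1) * ξ (n - 1) - d n * ξ n + b n * ξ (n + 1) = 0) ∧
      ξ M = 0 ∧ ξ (M + 1) = 1 := by
  set Θ := jacobiStep d b hb
  let z : ℤ → ℤ × ℝ × ℝ := fun n => (Θ ^ (n - M)) (M, 0, 1)
  have hz : ∀ n, z (n + 1) = Θ (z n) := fun n => by
    simp only [z]
    rw [show n + 1 - M = 1 + (n - M) by ring, zpow_add, zpow_one, Equiv.Perm.mul_apply]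
  have hzM : z M = (M, 0, 1) := by simp [z]
  have hz1 : ∀ n, (z n).1 = n := by
    intro n
    induction n using Int.inductionOn' (b := M) with
    | zero => rw [hzM]
    | succ k _ ih => rw [hz]; exact congrArg (· + 1) ih
    | pred k _ ih =>
      have h := hz (k - 1)
      rw [sub_add_cancel] at h
      have h' : (z k).1 = (z (k - 1)).1 + 1 := by rw [h]; rfl
      linarith
  have h2 : ∀ n, (z n).2.2 = (z (n + 1)).2.1 := fun n => by rw [hz]; rfl
  refine ⟨fun n => (z n).2.1, fun n => ?_, by simp [hzM], ?_⟩
  · have h := hz (n - 1)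
    rw [sub_add_cancel] at h
    have h3 : (z n).2.2 = (d n * (z n).2.1 - b (n - 1) * (z (n - 1)).2.1) / b n := by
      have e : (z n).2.2 = (Θ (z (n - 1))).2.2 := by rw [h]
      rw [e]
      change (d ((z (n - 1)).1 + 1) * (z (n - 1)).2.2 - b (z (n - 1)).1 * (z (n - 1)).2.1)
        / b ((z (n - 1)).1 + 1) = _
      rw [hz1, h2, sub_add_cancel]
    rw [h2, eq_div_iff (hb n)] at h3
    linear_combination h3
  · change (z (M + 1)).2.1 = 1
    rw [← h2, hzM]

variable {X : Type*} (T : Equiv.Perm X) (d b : X → ℝ)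

/-- The ratio `ξ₁ / ξ₀` along the orbit of `p`, for the solution `ξ` of the Jacobi equation which
vanishes at time `-(j + 1)`. -/
def riccati : ℕ → X → ℝ
  | 0, p => d p / b p
  | j + 1, p => (d p - b (T.symm p) / riccati j (T.symm p)) / b p

/-- The sequence `ξ` solves the Jacobi equation along the orbit of `p`. -/
def IsJacobiAlong (p : X) (ξ : ℤ → ℝ) : Prop :=
  ∀ n : ℤ, b ((T ^ (n - 1)) p) * ξ (n - 1) - d ((T ^ n) p) * ξ n + b ((T ^ n) p) * ξ (n + 1) = 0

/-- Start a solution with values `0, 1` at the times `-j - 1, -j`. Its successive ratios are the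
iterates along the orbit, so a zero of the `j`-th iterate at `p` forces a second zero of the
solution, at time `1`. The earlier iterates must not vanish, since the recursion divides by them. -/
lemma riccati_ne_zero (hb : ∀ p, 0 < b p)
    (hT : ∀ p ξ, IsJacobiAlong T d b p ξ → ∀ M N, M ≠ N → ξ M = 0 → ξ N = 0 → ξ = 0)
    (j : ℕ) (hj : ∀ i < j, ∀ p, 0 < riccati T d b i p) (p : X) : riccati T d b j p ≠ 0 := by
  intro h0
  obtain ⟨ξ, hξ, hM, hM1⟩ := exists_jacobi_sequence (fun n : ℤ => d ((T ^ n) p))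
    (fun n : ℤ => b ((T ^ n) p)) (fun n => (hb _).ne') (-(j : ℤ) - 1)
  rw [sub_add_cancel] at hM1
  have key : ∀ i : ℕ, i ≤ j → ξ (-(j : ℤ) + i) ≠ 0 ∧
      ξ (-(j : ℤ) + i + 1) = riccati T d b i ((T ^ (-(j : ℤ) + i)) p) * ξ (-(j : ℤ) + i) := by
    intro i
    induction i with
    | zero =>
      intro _
      have h := hξ (-(j : ℤ))
      simp only [hM, hM1] at h
      simp only [Nat.cast_zero, add_zero, hM1, riccati]
      refine ⟨one_ne_zero, ?_⟩
      have := (hb ((T ^ (-(j : ℤ))) p)).ne'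
      field_simp
      linear_combination h
    | succ i ih =>
      intro hi
      obtain ⟨h1, h2⟩ := ih (by omega)
      have hf := (hj i (by omega) ((T ^ (-(j : ℤ) + i)) p)).ne'
      have h := hξ (-(j : ℤ) + i + 1)
      simp only [add_sub_cancel_right] at h
      rw [show (-(j : ℤ) + ((i + 1 : ℕ) : ℤ)) = -(j : ℤ) + i + 1 by push_cast; ring]
      refine ⟨by rw [h2]; exact mul_ne_zero hf h1, ?_⟩
      have hs : T.symm ((T ^ (-(j : ℤ) + i + 1)) p) = (T ^ (-(j : ℤ) + i)) p := by
        rw [Equiv.symm_apply_eq, add_comm _ (1 : ℤ), zpow_add, zpow_one, Equiv.Perm.mul_apply]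
      simp only [riccati]
      rw [hs]
      have := (hb ((T ^ (-(j : ℤ) + i + 1)) p)).ne'
      rw [h2] at h ⊢
      field_simp
      field_simp at h
      linear_combination h
  obtain ⟨-, h2⟩ := key j le_rfl
  simp only [neg_add_cancel, zpow_zero, Equiv.Perm.one_apply, h0, zero_mul, zero_add] at h2
  have := hT p ξ hξ _ 1 (by omega) hM h2
  rw [this] at hM1
  exact zero_ne_one hM1

variable [TopologicalSpace X]

lemma continuous_riccati (hb : ∀ p, 0 < b p) (hbc : Continuous b) (hdc : Continuous d)
    (hTc : Continuous T.symm) (j : ℕ) (hj : ∀ i < j, ∀ p, 0 < riccati T d b i p) :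
    Continuous (riccati T d b j) := by
  induction j with
  | zero => exact hdc.div hbc fun p => (hb p).ne'
  | succ j ih =>
    refine (hdc.sub ((hbc.comp hTc).div ((ih fun i hi => hj i (by omega)).comp hTc) ?_)).div hbc
      fun p => (hb p).ne'
    exact fun p => (hj j (by omega) _).ne'

/-- Positivity of the solutions of the Jacobi equation without conjugate points spreads from one
orbit over the connected phase space. -/
lemma riccati_pos [PreconnectedSpace X] (hb : ∀ p, 0 < b p) (hbc : Continuous b)
    (hdc : Continuous d) (hTc : Continuous T.symm)
    (hT : ∀ p ξ, IsJacobiAlong T d b p ξ → ∀ M N, M ≠ N → ξ M = 0 → ξ N = 0 → ξ = 0)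
    {p₀ : X} (hp₀ : ∀ j, 0 < riccati T d b j p₀) (j : ℕ) : ∀ p, 0 < riccati T d b j p := by
  induction j using Nat.strong_induction_on with
  | _ j ih =>
    intro p
    have hc := continuous_riccati T d b hb hbc hdc hTc j ih
    have hne := riccati_ne_zero T d b hb hT j ih
    by_contra! hle
    obtain ⟨q, hq⟩ := mem_range_of_exists_le_of_exists_ge hc ⟨p, hle⟩ ⟨p₀, (hp₀ j).le⟩
    exact hne q hq

lemma exists_positive_cocycle [MeasurableSpace X] [BorelSpace X] (hb : ∀ p, 0 < b p)
    (hbc : Continuous b) (hdc : Continuous d) (hTc : Continuous T.symm)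
    (hpos : ∀ j p, 0 < riccati T d b j p) :
    ∃ ν : X → ℝ, Measurable ν ∧ (∀ p, 0 < ν p) ∧
      (∀ p, b p * ν p + b (T.symm p) / ν (T.symm p) = d p) ∧
      ∀ p, Tendsto (fun j => riccati T d b j p) atTop (𝓝 (ν p)) := by
  -- On positive values the Riccati recursion is increasing in the previous iterate, and the first
  -- step only subtracts a positive term.
  have hanti : ∀ j p, riccati T d b (j + 1) p ≤ riccati T d b j p := by
    intro j
    induction j with
    | zero =>
      intro p
      simp only [riccati]
      have h1 := hpos 0 (T.symm p)
      simp only [riccati] at h1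
      have h2 := div_pos (hb (T.symm p)) h1
      exact div_le_div_of_nonneg_right (by linarith) (hb p).le
    | succ j ih =>
      intro p
      change (d p - b (T.symm p) / riccati T d b (j + 1) (T.symm p)) / b p ≤
        (d p - b (T.symm p) / riccati T d b j (T.symm p)) / b p
      have h1 := hpos (j + 1) (T.symm p)
      have h2 := div_le_div_of_nonneg_left (hb (T.symm p)).le h1 (ih (T.symm p))
      exact div_le_div_of_nonneg_right (by linarith) (hb p).le
  have hd : ∀ p, 0 < d p := fun p => by
    have := hpos 0 p
    simp only [riccati] at this
    exact (div_pos_iff_of_pos_right (hb p)).1 this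
  have hlow : ∀ j p, b p / d (T p) ≤ riccati T d b j p := by
    intro j p
    have h := hpos (j + 1) (T p)
    rw [riccati, T.symm_apply_apply, div_pos_iff_of_pos_right (hb _), sub_pos,
      div_lt_iff₀ (hpos j p)] at h
    rw [div_le_iff₀ (hd _)]
    linarith
  have hlim : ∀ p, Tendsto (fun j => riccati T d b j p) atTop (𝓝 (⨅ j, riccati T d b j p)) :=
    fun p => tendsto_atTop_ciInf (antitone_nat_of_succ_le fun j => hanti j p)
      ⟨0, by rintro _ ⟨j, rfl⟩; exact (hpos j p).le⟩
  have hνpos : ∀ p, 0 < ⨅ j, riccati T d b j p := fun p =>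
    lt_of_lt_of_le (div_pos (hb p) (hd (T p))) (le_ciInf fun j => hlow j p)
  refine ⟨fun p => ⨅ j, riccati T d b j p, ?_, hνpos, fun p => ?_, hlim⟩
  · refine measurable_of_tendsto_metrizable (f := fun j p => riccati T d b j p) (fun j =>
      (continuous_riccati T d b hb hbc hdc hTc j fun i _ => hpos i).measurable) ?_
    exact tendsto_pi_nhds.2 hlim
  · have h1 := (hlim p).comp (tendsto_add_atTop_nat 1)
    have h2 : Tendsto (fun j => (d p - b (T.symm p) / riccati T d b j (T.symm p)) / b p) atTop
        (𝓝 ((d p - b (T.symm p) / ⨅ j, riccati T d b j (T.symm p)) / b p)) :=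
      ((tendsto_const_nhds.div (hlim (T.symm p)) (hνpos _).ne').const_sub (d p)).div_const _
    have h3 := tendsto_nhds_unique h1 h2
    simp only [] at h3 ⊢
    rw [h3]
    have := (hb p).ne'
    field_simp
    ring

end Riccati

/-! ### Chords by departure angle, and the billiard map on the universal cover. -/

namespace ConvexBilliard

open Set Filter Topology

variable {S : Model} (c : ConvexBilliard S)

instance : Fact (0 < c.P) := ⟨c.P_pos⟩

lemma point_coe (x : ℝ) : c.point (x : AddCircle c.P) = c.γ x := rfl

lemma coe_eq_coe_iff {x y : ℝ} : (x : AddCircle c.P) = y ↔ c.γ x = c.γ y :=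
  ⟨fun h => by rw [← point_coe, h, point_coe], c.simple x y⟩

lemma coe_add_P (x : ℝ) : ((x + c.P : ℝ) : AddCircle c.P) = x := by simp

lemma coe_sub_P (x : ℝ) : ((x - c.P : ℝ) : AddCircle c.P) = x := by simp

lemma periodic_deriv : Function.Periodic (deriv c.γ) c.P := fun x => by
  rw [← deriv_comp_add_const]
  exact congrArg (fun f => deriv f x) (funext c.periodic)

lemma periodic_deriv_deriv : Function.Periodic (deriv (deriv c.γ)) c.P := fun x => by
  rw [← deriv_comp_add_const]
  exact congrArg (fun f => deriv f x) (funext c.periodic_deriv)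

section Congr

variable {c} {x x' y y' : ℝ}

lemma γ_congr (hx : (x : AddCircle c.P) = x') : c.γ x = c.γ x' := c.coe_eq_coe_iff.1 hx

lemma deriv_γ_congr (hx : (x : AddCircle c.P) = x') : deriv c.γ x = deriv c.γ x' := by
  rw [← c.periodic_deriv.lift_coe, hx, c.periodic_deriv.lift_coe]

lemma deriv_deriv_γ_congr (hx : (x : AddCircle c.P) = x') :
    deriv (deriv c.γ) x = deriv (deriv c.γ) x' := by
  rw [← c.periodic_deriv_deriv.lift_coe, hx, c.periodic_deriv_deriv.lift_coe]

lemma k_congr (hx : (x : AddCircle c.P) = x') : c.k x = c.k x' := by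
  rw [k, γ_congr hx, deriv_γ_congr hx, deriv_deriv_γ_congr hx, k]

lemma tang_congr (hx : (x : AddCircle c.P) = x') (hy : (y : AddCircle c.P) = y') :
    c.tang x y = c.tang x' y' := by
  rw [tang, deriv_γ_congr hx, γ_congr hy, tang]

lemma nor_congr (hx : (x : AddCircle c.P) = x') (hy : (y : AddCircle c.P) = y') :
    c.nor x y = c.nor x' y' := by
  rw [nor, deriv_γ_congr hx, γ_congr hx, γ_congr hy, nor]

lemma L_congr (hx : (x : AddCircle c.P) = x') (hy : (y : AddCircle c.P) = y') :
    c.L x y = c.L x' y' := by rw [L, γ_congr hx, γ_congr hy, L]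

lemma chord_congr (hx : (x : AddCircle c.P) = x') (hy : (y : AddCircle c.P) = y') :
    c.chord x y = c.chord x' y' := by rw [chord, L_congr hx hy, chord]

lemma L₁₁_congr (hx : (x : AddCircle c.P) = x') (hy : (y : AddCircle c.P) = y')
    (h : c.γ x ≠ c.γ y) : c.L₁₁ x y = c.L₁₁ x' y' := by
  rw [L₁₁_eq h, nor_congr hx hy, chord_congr hx hy, L_congr hx hy, k_congr hx,
    L₁₁_eq (γ_congr hx ▸ γ_congr hy ▸ h)]

lemma L₁₂_congr (hx : (x : AddCircle c.P) = x') (hy : (y : AddCircle c.P) = y')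
    (h : c.γ x ≠ c.γ y) : c.L₁₂ x y = c.L₁₂ x' y' := by
  rw [L₁₂_eq h, nor_congr hx hy, chord_congr hx hy, nor_congr hy hx,
    L₁₂_eq (γ_congr hx ▸ γ_congr hy ▸ h)]

end Congr

variable {c} in
lemma γ_ne_of_mem_Ioo {x y : ℝ} (h : y ∈ Ioo x (x + c.P)) : c.γ x ≠ c.γ y := fun e =>
  h.1.ne ((AddCircle.coe_eq_coe_iff_of_mem_Ico (p := c.P) (a := x)
    ⟨le_rfl, by linarith [c.P_pos]⟩ ⟨h.1.le, h.2⟩).1 (c.coe_eq_coe_iff.2 e))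

/-- The cosine of the angle at `x` between the boundary and the chord to `y`. -/
def cosChord (x y : ℝ) : ℝ := c.tang x y / c.chord x y

variable {c} in
lemma cosChord_congr {x x' y y' : ℝ} (hx : (x : AddCircle c.P) = x')
    (hy : (y : AddCircle c.P) = y') : c.cosChord x y = c.cosChord x' y' := by
  rw [cosChord, tang_congr hx hy, chord_congr hx hy, cosChord]

section Distinct

variable {c} {x y : ℝ}

lemma L₁_eq_cosChord (h : c.γ x ≠ c.γ y) : c.L₁ x y = -c.cosChord x y := L₁_eq h

lemma cosChord_mem (h : c.γ x ≠ c.γ y) : c.cosChord x y ∈ Ioo (-1 : ℝ) 1 := by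
  have hW := chord_pos h
  have hs := chord_sq h
  have hn := nor_pos h
  have : |c.cosChord x y| < 1 := by
    rw [cosChord, abs_div, abs_of_pos hW, div_lt_one hW]
    exact abs_lt_of_sq_lt_sq (by nlinarith) hW.le
  exact abs_lt.1 this

lemma sin_arccos_cosChord (h : c.γ x ≠ c.γ y) :
    Real.sin (Real.arccos (c.cosChord x y)) = c.nor x y / c.chord x y := by
  have hW := chord_pos h
  have hn := nor_pos h
  rw [Real.sin_arccos, Real.sqrt_eq_iff_mul_self_eq_of_pos (by positivity), cosChord]
  field_simp
  linear_combination -chord_sq h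

lemma L₁₂_pos (h : c.γ x ≠ c.γ y) : 0 < c.L₁₂ x y := by
  rw [L₁₂_eq h]
  have := chord_pos h
  have := nor_pos h
  have := nor_pos h.symm
  positivity

lemma continuousAt_L (h : c.γ x ≠ c.γ y) : ContinuousAt (fun p : ℝ × ℝ => c.L p.1 p.2) (x, y) := by
  have e : (fun p : ℝ × ℝ => c.L p.1 p.2) = S.distOfForm ∘ fun p : ℝ × ℝ => c.pairing p.1 p.2 :=
    funext fun p => S.geodDist_eq _ _
  rw [e]
  exact ContinuousAt.comp (x := (x, y))
    (Model.hasDerivAt_distOfForm (pairing_mem_offDiag h)).continuousAt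
    c.continuous_pairing.continuousAt

lemma continuousAt_chord (h : c.γ x ≠ c.γ y) :
    ContinuousAt (fun p : ℝ × ℝ => c.chord p.1 p.2) (x, y) :=
  ContinuousAt.comp (x := (x, y)) (S.hasDerivAt_Y _).continuousAt (continuousAt_L h)

lemma continuousAt_cosChord (h : c.γ x ≠ c.γ y) :
    ContinuousAt (fun p : ℝ × ℝ => c.cosChord p.1 p.2) (x, y) :=
  c.continuous_tang.continuousAt.div (continuousAt_chord h) (chord_pos h).ne'

lemma continuousAt_L₁₂ (h : c.γ x ≠ c.γ y) :
    ContinuousAt (fun p : ℝ × ℝ => c.L₁₂ p.1 p.2) (x, y) := by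
  have hne : ∀ᶠ p : ℝ × ℝ in 𝓝 (x, y), c.γ p.1 ≠ c.γ p.2 :=
    (isOpen_ne_fun (c.continuous_γ.comp continuous_fst)
      (c.continuous_γ.comp continuous_snd)).mem_nhds h
  have hf : ContinuousAt (fun p : ℝ × ℝ => c.nor p.1 p.2 * c.nor p.2 p.1 / c.chord p.1 p.2 ^ 3)
      (x, y) :=
    ((c.continuous_nor.mul (c.continuous_nor.comp continuous_swap)).continuousAt).div
      ((continuousAt_chord h).pow 3) (pow_ne_zero 3 (chord_pos h).ne')
  refine hf.congr ?_
  filter_upwards [hne] with p hp using (L₁₂_eq hp).symm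

lemma continuousAt_L₁₁ (h : c.γ x ≠ c.γ y) :
    ContinuousAt (fun p : ℝ × ℝ => c.L₁₁ p.1 p.2) (x, y) := by
  have hne : ∀ᶠ p : ℝ × ℝ in 𝓝 (x, y), c.γ p.1 ≠ c.γ p.2 :=
    (isOpen_ne_fun (c.continuous_γ.comp continuous_fst)
      (c.continuous_γ.comp continuous_snd)).mem_nhds h
  have hW := (chord_pos h).ne'
  have hn : ContinuousAt (fun p : ℝ × ℝ => c.nor p.1 p.2 / c.chord p.1 p.2) (x, y) :=
    c.continuous_nor.continuousAt.div (continuousAt_chord h) hW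
  have hd : ContinuousAt (fun p : ℝ × ℝ => S.dY (c.L p.1 p.2) / S.Y (c.L p.1 p.2)) (x, y) :=
    (ContinuousAt.comp (x := (x, y)) (S.hasDerivAt_dY _).continuousAt (continuousAt_L h)).div
      (continuousAt_chord h) hW
  have hf := ((hn.pow 2).mul hd).sub
    ((c.continuous_k.comp continuous_fst).continuousAt.mul hn)
  refine hf.congr ?_
  filter_upwards [hne] with p hp using (L₁₁_eq hp).symm

end Distinct

/-- The twist property: the derivative in the end point is `-L₁₂`, which is negative. -/
lemma strictAntiOn_cosChord (x : ℝ) : StrictAntiOn (c.cosChord x) (Ioo x (x + c.P)) := by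
  have hd : ∀ y ∈ Ioo x (x + c.P), HasDerivAt (c.cosChord x) (-c.L₁₂ x y) y := fun y hy => by
    rw [L₁₂_eq (γ_ne_of_mem_Ioo hy)]
    exact hasDerivAt_tang_div_chord (γ_ne_of_mem_Ioo hy)
  refine strictAntiOn_of_deriv_neg (convex_Ioo _ _)
    (fun y hy => (hd y hy).continuousAt.continuousWithinAt) fun y hy => ?_
  rw [interior_Ioo] at hy
  rw [(hd y hy).deriv]
  exact neg_neg_of_pos (L₁₂_pos (γ_ne_of_mem_Ioo hy))

lemma exists_cosChord_eq (x : ℝ) {Φ : ℝ} (hΦ : Φ ∈ Ioo (-1 : ℝ) 1) :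
    ∃ y ∈ Ioo x (x + c.P), c.cosChord x y = Φ := by
  have hP := c.P_pos
  have hs1 : 0 < 1 - Φ ^ 2 := by nlinarith [hΦ.1, hΦ.2]
  set s := √(1 - Φ ^ 2) with hs
  have hspos : 0 < s := Real.sqrt_pos.2 hs1
  have hsq : s ^ 2 = 1 - Φ ^ 2 := Real.sq_sqrt hs1.le
  -- For `Φ = cos φ` and a chord at angle `θ`, this is `chord · sin (φ - θ)`. Unlike `cosChord` it
  -- is smooth on the diagonal. It vanishes at `x` and at `x + P` with slope `s > 0`, hence it is
  -- positive just after `x`, negative just before `x + P`, and zero at some point between.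
  let h : ℝ → ℝ := fun y => s * c.tang x y - Φ * c.nor x y
  have hd : ∀ z : ℝ, (z : AddCircle c.P) = x → h z = 0 ∧ HasDerivAt h s z := fun z hz => by
    constructor
    · simp only [h]
      rw [tang_congr rfl hz, nor_congr rfl hz, tang, nor, S.form_comm, c.form_γ_deriv,
        S.form_leftNormal_left]
      ring
    · refine (((c.hasDerivAt_tang_right x z).const_mul s).sub
        ((c.hasDerivAt_nor_right x z).const_mul Φ)).congr_deriv ?_
      rw [deriv_γ_congr hz, c.unit_speed, S.form_leftNormal_right]
      ring
  have hcont : Continuous h :=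
    (continuous_const.mul (c.continuous_tang.comp (Continuous.prodMk_right x))).sub
      (continuous_const.mul (c.continuous_nor.comp (Continuous.prodMk_right x)))
  have hsign : ∀ z : ℝ, (z : AddCircle c.P) = x →
      ∀ᶠ y in 𝓝 z, SignType.sign (h y) = SignType.sign (y - z) := fun z hz =>
    eventually_nhdsWithin_sign_eq_of_deriv_pos (by rw [(hd z hz).2.deriv]; exact hspos) (hd z hz).1
  obtain ⟨y₁, hy₁, hy₁'⟩ : ∃ y₁ ∈ Ioo x (x + c.P / 2), 0 < h y₁ := by
    have h1 : ∀ᶠ y in 𝓝[>] x, SignType.sign (h y) = SignType.sign (y - x) :=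
      (hsign x rfl).filter_mono nhdsWithin_le_nhds
    obtain ⟨y, hy, hy'⟩ := (h1.and (Ioo_mem_nhdsGT (show x < x + c.P / 2 by linarith))).exists
    rw [sign_pos (sub_pos.2 hy'.1), sign_eq_one_iff] at hy
    exact ⟨y, hy', hy⟩
  obtain ⟨y₂, hy₂, hy₂'⟩ : ∃ y₂ ∈ Ioo (x + c.P / 2) (x + c.P), h y₂ < 0 := by
    have h1 : ∀ᶠ y in 𝓝[<] (x + c.P), SignType.sign (h y) = SignType.sign (y - (x + c.P)) :=
      (hsign _ (c.coe_add_P x)).filter_mono nhdsWithin_le_nhds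
    obtain ⟨y, hy, hy'⟩ :=
      (h1.and (Ioo_mem_nhdsLT (show x + c.P / 2 < x + c.P by linarith))).exists
    rw [sign_neg (sub_neg.2 hy'.2), sign_eq_neg_one_iff] at hy
    exact ⟨y, hy', hy⟩
  obtain ⟨y, hy, hy0⟩ := intermediate_value_Icc' (show y₁ ≤ y₂ by linarith [hy₁.2, hy₂.1])
    hcont.continuousOn ⟨hy₂'.le, hy₁'.le⟩
  have hmem : y ∈ Ioo x (x + c.P) := ⟨hy₁.1.trans_le hy.1, hy.2.trans_lt hy₂.2⟩
  have hne := γ_ne_of_mem_Ioo hmem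
  have hn := nor_pos hne
  have hW : c.chord x y = c.nor x y / s := by
    have hsqW : c.chord x y ^ 2 = (c.nor x y / s) ^ 2 := by
      rw [chord_sq hne, div_pow, eq_div_iff (by positivity)]
      have e : s * c.tang x y = Φ * c.nor x y := sub_eq_zero.1 hy0
      linear_combination (s * c.tang x y + Φ * c.nor x y) * e + c.nor x y ^ 2 * hsq
    exact (pow_left_inj₀ (chord_pos hne).le (by positivity) two_ne_zero).1 hsqW
  refine ⟨y, hmem, ?_⟩
  rw [cosChord, hW]
  have e : s * c.tang x y = Φ * c.nor x y := sub_eq_zero.1 hy0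
  field_simp
  linear_combination e

/-- The end point, to the right of `x` and within one period, of the chord which leaves `x` at the
angle with cosine `Φ`. -/
def next (x : ℝ) (Φ : Ioo (-1 : ℝ) 1) : ℝ := (c.exists_cosChord_eq x Φ.2).choose

lemma next_mem (x : ℝ) (Φ : Ioo (-1 : ℝ) 1) : c.next x Φ ∈ Ioo x (x + c.P) :=
  (c.exists_cosChord_eq x Φ.2).choose_spec.1

lemma cosChord_next (x : ℝ) (Φ : Ioo (-1 : ℝ) 1) : c.cosChord x (c.next x Φ) = Φ :=
  (c.exists_cosChord_eq x Φ.2).choose_spec.2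

lemma next_eq {x y : ℝ} {Φ : Ioo (-1 : ℝ) 1} (hy : y ∈ Ioo x (x + c.P))
    (h : c.cosChord x y = Φ) : c.next x Φ = y :=
  (c.strictAntiOn_cosChord x).injOn (c.next_mem x Φ) hy ((c.cosChord_next x Φ).trans h.symm)

lemma γ_ne_next (x : ℝ) (Φ : Ioo (-1 : ℝ) 1) : c.γ x ≠ c.γ (c.next x Φ) :=
  γ_ne_of_mem_Ioo (c.next_mem x Φ)

/-- By strict monotonicity, comparing `next` with a fixed `z` amounts to comparing `Φ` with
`cosChord x z`, which is an open condition in `(x, Φ)`. -/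
lemma continuous_next : Continuous fun q : ℝ × Ioo (-1 : ℝ) 1 => c.next q.1 q.2 := by
  refine continuous_iff_continuousAt.2 fun ⟨x, Φ⟩ => ?_
  have hy := c.next_mem x Φ
  have hanti := c.strictAntiOn_cosChord
  have hev : ∀ z ∈ Ioo x (x + c.P),
      ∀ᶠ q : ℝ × Ioo (-1 : ℝ) 1 in 𝓝 (x, Φ), z ∈ Ioo q.1 (q.1 + c.P) := by
    intro z hz
    have h1 : Continuous fun q : ℝ × Ioo (-1 : ℝ) 1 => q.1 := continuous_fst
    filter_upwards [h1.continuousAt.eventually_lt (continuousAt_const (y := z)) hz.1,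
      (continuousAt_const (y := z)).eventually_lt (h1.add_const c.P).continuousAt hz.2]
      with q h1 h2 using ⟨h1, h2⟩
  have hcc : ∀ z ∈ Ioo x (x + c.P),
      ContinuousAt (fun q : ℝ × Ioo (-1 : ℝ) 1 => c.cosChord q.1 z) (x, Φ) := fun z hz =>
    ContinuousAt.comp (f := fun q : ℝ × Ioo (-1 : ℝ) 1 => (q.1, z)) (x := (x, Φ))
      (continuousAt_cosChord (γ_ne_of_mem_Ioo hz)) (by fun_prop)
  have hΦc : ContinuousAt (fun q : ℝ × Ioo (-1 : ℝ) 1 => (q.2 : ℝ)) (x, Φ) := by fun_prop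
  refine tendsto_order.2 ⟨fun a ha => ?_, fun a ha => ?_⟩
  · obtain ⟨z, hz1, hz2⟩ := exists_between (max_lt ha hy.1)
    have hz : z ∈ Ioo x (x + c.P) := ⟨(le_max_right _ _).trans_lt hz1, hz2.trans hy.2⟩
    have hlt : (Φ : ℝ) < c.cosChord x z := by
      rw [← c.cosChord_next x Φ]; exact hanti x hz hy hz2
    filter_upwards [hev z hz, hΦc.eventually_lt (hcc z hz) hlt] with q hq1 hq2
    refine lt_of_le_of_lt (le_max_left _ x |>.trans hz1.le) ?_
    rw [← c.cosChord_next q.1 q.2] at hq2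
    exact ((hanti q.1).lt_iff_gt (c.next_mem _ _) hq1).1 hq2
  · obtain ⟨z, hz1, hz2⟩ := exists_between (lt_min ha hy.2)
    have hz : z ∈ Ioo x (x + c.P) := ⟨hy.1.trans hz1, hz2.trans_le (min_le_right _ _)⟩
    have hlt : c.cosChord x z < (Φ : ℝ) := by
      rw [← c.cosChord_next x Φ]; exact hanti x hy hz hz1
    filter_upwards [hev z hz, (hcc z hz).eventually_lt hΦc hlt] with q hq1 hq2
    refine lt_of_lt_of_le ?_ (hz2.le.trans (min_le_left _ (x + c.P)))
    rw [← c.cosChord_next q.1 q.2] at hq2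
    exact ((hanti q.1).lt_iff_gt hq1 (c.next_mem _ _)).1 hq2

lemma neg_mem_Ioo_neg_one_one {r : ℝ} (h : r ∈ Ioo (-1 : ℝ) 1) : -r ∈ Ioo (-1 : ℝ) 1 :=
  ⟨by linarith [h.2], by linarith [h.1]⟩

/-- The billiard map on the universal cover of the phase cylinder. -/
def liftMap : Equiv.Perm (ℝ × Ioo (-1 : ℝ) 1) where
  toFun q := (c.next q.1 q.2,
    ⟨-c.cosChord (c.next q.1 q.2) q.1,
      neg_mem_Ioo_neg_one_one (cosChord_mem (c.γ_ne_next _ _).symm)⟩)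
  -- Time reversal: leaving with the opposite cosine retraces the incoming chord. Since `next`
  -- always moves to the right, one period is subtracted to undo the forward step on the cover.
  invFun q := (c.next q.1 ⟨-q.2, neg_mem_Ioo_neg_one_one q.2.2⟩ - c.P,
    ⟨c.cosChord (c.next q.1 ⟨-q.2, neg_mem_Ioo_neg_one_one q.2.2⟩) q.1,
      cosChord_mem (c.γ_ne_next _ _).symm⟩)
  left_inv := by
    rintro ⟨x, Φ⟩
    have hy := c.next_mem x Φ
    have e : ∀ h, c.next (c.next x Φ) ⟨- -c.cosChord (c.next x Φ) x, h⟩ = x + c.P := fun h =>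
      c.next_eq ⟨hy.2, by linarith [hy.1]⟩ (by
        rw [cosChord_congr rfl (c.coe_add_P x)]; simp)
    simp only [e, add_sub_cancel_right, Prod.mk.injEq, true_and]
    refine Subtype.ext ?_
    simp only
    rw [cosChord_congr (c.coe_add_P x) rfl, cosChord_next]
  right_inv := by
    rintro ⟨y, Ψ⟩
    set Ψ' : Ioo (-1 : ℝ) 1 := ⟨-Ψ, neg_mem_Ioo_neg_one_one Ψ.2⟩ with hΨ'
    have hz := c.next_mem y Ψ'
    have e : ∀ h, c.next (c.next y Ψ' - c.P) ⟨c.cosChord (c.next y Ψ') y, h⟩ = y := fun h =>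
      c.next_eq ⟨by linarith [hz.2], by linarith [hz.1]⟩ (by
        rw [cosChord_congr (c.coe_sub_P _) rfl])
    simp only [← hΨ', e, Prod.mk.injEq, true_and]
    refine Subtype.ext ?_
    simp only
    rw [cosChord_congr rfl (c.coe_sub_P _), cosChord_next, hΨ']
    simp

lemma liftMap_fst (q : ℝ × Ioo (-1 : ℝ) 1) : (c.liftMap q).1 = c.next q.1 q.2 := rfl

lemma liftMap_snd (q : ℝ × Ioo (-1 : ℝ) 1) :
    ((c.liftMap q).2 : ℝ) = -c.cosChord (c.liftMap q).1 q.1 := rfl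

lemma cosChord_liftMap (q : ℝ × Ioo (-1 : ℝ) 1) : c.cosChord q.1 (c.liftMap q).1 = q.2 :=
  c.cosChord_next _ _

lemma γ_ne_liftMap (q : ℝ × Ioo (-1 : ℝ) 1) : c.γ q.1 ≠ c.γ (c.liftMap q).1 := c.γ_ne_next _ _

lemma γ_symm_ne (q : ℝ × Ioo (-1 : ℝ) 1) : c.γ (c.liftMap.symm q).1 ≠ c.γ q.1 := by
  simpa using c.γ_ne_liftMap (c.liftMap.symm q)

lemma continuous_liftMap : Continuous c.liftMap := by
  refine c.continuous_next.prodMk (Continuous.subtype_mk ?_ _)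
  refine Continuous.neg (continuous_iff_continuousAt.2 fun q => ?_)
  exact ContinuousAt.comp (f := fun q : ℝ × Ioo (-1 : ℝ) 1 => (c.next q.1 q.2, q.1))
    (continuousAt_cosChord (c.γ_ne_next q.1 q.2).symm)
    (c.continuous_next.prodMk continuous_fst).continuousAt

lemma continuous_liftMap_symm : Continuous c.liftMap.symm := by
  have hn : Continuous fun q : ℝ × Ioo (-1 : ℝ) 1 =>
      c.next q.1 ⟨-q.2, neg_mem_Ioo_neg_one_one q.2.2⟩ :=
    c.continuous_next.comp (f := fun q : ℝ × Ioo (-1 : ℝ) 1 =>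
      (q.1, (⟨-q.2, neg_mem_Ioo_neg_one_one q.2.2⟩ : Ioo (-1 : ℝ) 1))) (by fun_prop)
  refine (hn.sub continuous_const).prodMk (Continuous.subtype_mk ?_ _)
  refine continuous_iff_continuousAt.2 fun q => ?_
  exact ContinuousAt.comp (f := fun q : ℝ × Ioo (-1 : ℝ) 1 =>
      (c.next q.1 ⟨-q.2, neg_mem_Ioo_neg_one_one q.2.2⟩, q.1))
    (continuousAt_cosChord (c.γ_ne_next _ _).symm) (hn.prodMk continuous_fst).continuousAt

end ConvexBilliard

/-! ### The Jacobi coefficients on the cover, their invariance under the period, and the diameter.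
-/

namespace ConvexBilliard

open Set Filter Topology

variable {S : Model} (c : ConvexBilliard S)

/-- The projection of the universal cover onto the phase cylinder. -/
def proj (q : ℝ × Ioo (-1 : ℝ) 1) : c.Phase := (q.1, q.2)

variable {c} in
lemma exists_mem_Ioo_coe_eq {x y : ℝ} (h : c.γ x ≠ c.γ y) :
    ∃ z ∈ Ioo x (x + c.P), (z : AddCircle c.P) = y := by
  have hm := toIcoMod_mem_Ico c.P_pos x y
  have he : ((toIcoMod c.P_pos x y : ℝ) : AddCircle c.P) = y := by
    rw [toIcoMod, AddCircle.coe_sub, AddCircle.coe_zsmul, AddCircle.coe_period]; simp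
  refine ⟨_, ⟨lt_of_le_of_ne hm.1 fun e => h ?_, hm.2⟩, he⟩
  rw [← e] at he
  exact c.coe_eq_coe_iff.1 he

variable {c} in
lemma coe_next_eq {x y : ℝ} {Φ : Ioo (-1 : ℝ) 1} (h : c.γ x ≠ c.γ y) (hc : c.cosChord x y = Φ) :
    (c.next x Φ : AddCircle c.P) = y := by
  obtain ⟨z, hz, hzy⟩ := exists_mem_Ioo_coe_eq h
  rw [c.next_eq hz (by rw [← hc]; exact cosChord_congr rfl hzy), hzy]

variable {c} in
lemma coe_next_congr {x x' : ℝ} (h : (x : AddCircle c.P) = x') (Φ : Ioo (-1 : ℝ) 1) :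
    (c.next x Φ : AddCircle c.P) = c.next x' Φ :=
  coe_next_eq (by rw [γ_congr h]; exact c.γ_ne_next x' Φ)
    (by rw [cosChord_congr h rfl, cosChord_next])

section Congr

variable {c} {q q' : ℝ × Ioo (-1 : ℝ) 1}

lemma coe_fst_eq (h : c.proj q = c.proj q') : (q.1 : AddCircle c.P) = q'.1 := congrArg Prod.fst h

lemma snd_eq (h : c.proj q = c.proj q') : q.2 = q'.2 := congrArg (fun z : c.Phase => z.2) h

lemma proj_liftMap_congr (h : c.proj q = c.proj q') :
    c.proj (c.liftMap q) = c.proj (c.liftMap q') := by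
  have h1 : ((c.liftMap q).1 : AddCircle c.P) = (c.liftMap q').1 := by
    rw [liftMap_fst, liftMap_fst, coe_next_congr (coe_fst_eq h), snd_eq h]
  refine Prod.ext h1 (Subtype.ext ?_)
  change ((c.liftMap q).2 : ℝ) = (c.liftMap q').2
  rw [liftMap_snd, liftMap_snd, cosChord_congr h1 (coe_fst_eq h)]

lemma proj_liftMap_symm_congr (h : c.proj q = c.proj q') :
    c.proj (c.liftMap.symm q) = c.proj (c.liftMap.symm q') := by
  have h2 := snd_eq h
  have h0 := coe_next_congr (coe_fst_eq h) ⟨-q.2, neg_mem_Ioo_neg_one_one q.2.2⟩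
  refine Prod.ext ?_ (Subtype.ext ?_)
  · change ((c.next q.1 ⟨-q.2, neg_mem_Ioo_neg_one_one q.2.2⟩ - c.P : ℝ) : AddCircle c.P)
      = ((c.next q'.1 ⟨-q'.2, neg_mem_Ioo_neg_one_one q'.2.2⟩ - c.P : ℝ) : AddCircle c.P)
    rw [coe_sub_P, coe_sub_P, h0]
    simp only [h2]
  · change c.cosChord (c.next q.1 ⟨-q.2, neg_mem_Ioo_neg_one_one q.2.2⟩) q.1
      = c.cosChord (c.next q'.1 ⟨-q'.2, neg_mem_Ioo_neg_one_one q'.2.2⟩) q'.1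
    rw [cosChord_congr h0 (coe_fst_eq h)]
    simp only [h2]

end Congr

/-- The off-diagonal coefficient of the Jacobi equation. -/
def offCoeff (q : ℝ × Ioo (-1 : ℝ) 1) : ℝ := c.L₁₂ q.1 (c.liftMap q).1

/-- The negative of the diagonal coefficient of the Jacobi equation. -/
def diagCoeff (q : ℝ × Ioo (-1 : ℝ) 1) : ℝ :=
  -(c.L₁₁ q.1 (c.liftMap.symm q).1 + c.L₁₁ q.1 (c.liftMap q).1)

lemma offCoeff_pos (q : ℝ × Ioo (-1 : ℝ) 1) : 0 < c.offCoeff q := L₁₂_pos (c.γ_ne_liftMap q)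

lemma continuous_offCoeff : Continuous c.offCoeff := by
  refine continuous_iff_continuousAt.2 fun q => ?_
  exact ContinuousAt.comp (f := fun q : ℝ × Ioo (-1 : ℝ) 1 => (q.1, (c.liftMap q).1))
    (continuousAt_L₁₂ (c.γ_ne_liftMap q))
    (continuous_fst.prodMk (continuous_fst.comp c.continuous_liftMap)).continuousAt

lemma continuous_diagCoeff : Continuous c.diagCoeff := by
  refine (Continuous.add ?_ ?_).neg
  · refine continuous_iff_continuousAt.2 fun q => ?_
    exact ContinuousAt.comp (f := fun q : ℝ × Ioo (-1 : ℝ) 1 => (q.1, (c.liftMap.symm q).1))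
      (continuousAt_L₁₁ (c.γ_symm_ne q).symm)
      (continuous_fst.prodMk (continuous_fst.comp c.continuous_liftMap_symm)).continuousAt
  · refine continuous_iff_continuousAt.2 fun q => ?_
    exact ContinuousAt.comp (f := fun q : ℝ × Ioo (-1 : ℝ) 1 => (q.1, (c.liftMap q).1))
      (continuousAt_L₁₁ (c.γ_ne_liftMap q))
      (continuous_fst.prodMk (continuous_fst.comp c.continuous_liftMap)).continuousAt

variable {c} in
lemma offCoeff_congr {q q' : ℝ × Ioo (-1 : ℝ) 1} (h : c.proj q = c.proj q') :
    c.offCoeff q = c.offCoeff q' :=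
  L₁₂_congr (coe_fst_eq h) (coe_fst_eq (proj_liftMap_congr h)) (c.γ_ne_liftMap q)

variable {c} in
lemma diagCoeff_congr {q q' : ℝ × Ioo (-1 : ℝ) 1} (h : c.proj q = c.proj q') :
    c.diagCoeff q = c.diagCoeff q' := by
  rw [diagCoeff, diagCoeff,
    L₁₁_congr (coe_fst_eq h) (coe_fst_eq (proj_liftMap_congr h)) (c.γ_ne_liftMap q),
    L₁₁_congr (coe_fst_eq h) (coe_fst_eq (proj_liftMap_symm_congr h)) (c.γ_symm_ne q).symm]

/-- The Riccati iterates of the billiard. -/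
abbrev ratio (j : ℕ) (q : ℝ × Ioo (-1 : ℝ) 1) : ℝ := riccati c.liftMap c.diagCoeff c.offCoeff j q

variable {c} in
lemma ratio_congr (j : ℕ) {q q' : ℝ × Ioo (-1 : ℝ) 1} (h : c.proj q = c.proj q') :
    c.ratio j q = c.ratio j q' := by
  induction j generalizing q q' with
  | zero => simp only [ratio, riccati, diagCoeff_congr h, offCoeff_congr h]
  | succ j ih =>
    have hs := proj_liftMap_symm_congr h
    have := ih hs
    simp only [ratio] at this
    simp only [ratio, riccati, diagCoeff_congr h, offCoeff_congr h, offCoeff_congr hs, this]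

lemma isConfiguration_orbit (q : ℝ × Ioo (-1 : ℝ) 1) :
    c.IsConfiguration fun n => ((c.liftMap ^ n) q).1 := by
  intro n
  have e1 : (c.liftMap ^ (n + 1)) q = c.liftMap ((c.liftMap ^ n) q) := by
    rw [add_comm, zpow_add, zpow_one, Equiv.Perm.mul_apply]
  have e2 : (c.liftMap ^ n) q = c.liftMap ((c.liftMap ^ (n - 1)) q) := by
    rw [← Equiv.Perm.mul_apply, ← zpow_one_add]; congr 2; ring
  simp only [e1]
  refine ⟨c.γ_ne_liftMap _, ?_⟩
  rw [L₁_eq_cosChord (c.γ_ne_liftMap _), cosChord_liftMap, L₂_eq_L₁, e2,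
    L₁_eq_cosChord (c.γ_ne_liftMap _).symm, liftMap_snd]
  ring

variable {c} in
lemma eq_zero_of_isJacobiAlong (hc : c.NoConjugatePoints) (q : ℝ × Ioo (-1 : ℝ) 1) (ξ : ℤ → ℝ)
    (hξ : IsJacobiAlong c.liftMap c.diagCoeff c.offCoeff q ξ) (M N : ℤ) (hMN : M ≠ N)
    (hM : ξ M = 0) (hN : ξ N = 0) : ξ = 0 := by
  by_contra hne
  refine hc _ (c.isConfiguration_orbit q) M N hMN ⟨ξ, fun n => ?_, hne, hM, hN⟩
  have e1 : (c.liftMap ^ (n + 1)) q = c.liftMap ((c.liftMap ^ n) q) := by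
    rw [add_comm, zpow_add, zpow_one, Equiv.Perm.mul_apply]
  have e2 : c.liftMap ((c.liftMap ^ (n - 1)) q) = (c.liftMap ^ n) q := by
    rw [← Equiv.Perm.mul_apply, ← zpow_one_add]; congr 2; ring
  have e3 : c.liftMap.symm ((c.liftMap ^ n) q) = (c.liftMap ^ (n - 1)) q := by
    rw [← e2, Equiv.symm_apply_apply]
  have h := hξ n
  rw [offCoeff, diagCoeff, offCoeff, e2, e3, ← e1] at h
  rw [L₂₂_eq_L₁₁]
  linear_combination h

/-! ### The diameter -/

lemma exists_pairing_le : ∃ x y : ℝ, ∀ x' y', c.pairing x y ≤ c.pairing x' y' := by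
  have hK : IsCompact (range c.γ) := c.periodic.compact_of_continuous c.P_pos.ne' c.continuous_γ
  obtain ⟨⟨u, v⟩, ⟨⟨x, rfl⟩, ⟨y, rfl⟩⟩, hmin⟩ :=
    (hK.prod hK).exists_isMinOn ((range_nonempty _).prod (range_nonempty _))
      (S.continuous_form continuous_fst continuous_snd).continuousOn
  exact ⟨x, y, fun s t => hmin (mk_mem_prod (mem_range_self s) (mem_range_self t))⟩

/-- The second derivative test at a minimum. -/
lemma nonneg_of_isMin {f f' : ℝ → ℝ} {s : ℝ} (hf : ∀ t, HasDerivAt f (f' t) t)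
    (hf' : HasDerivAt f' s 0) (hmin : ∀ t, f 0 ≤ f t) : 0 ≤ s := by
  by_contra! hs
  have hd : deriv f = f' := funext fun t => (hf t).deriv
  have h0 : f' 0 = 0 :=
    (show IsLocalMin f 0 from Eventually.of_forall hmin).hasDerivAt_eq_zero (hf 0)
  -- With `s < 0` the minimum is also a local maximum, so `f` is locally constant and `s = 0`.
  have hmax := isLocalMax_of_deriv_deriv_neg (f := f) (x₀ := 0) (by rw [hd, hf'.deriv]; exact hs)
    (by rw [hd, h0]) (hf 0).continuousAt
  have hconst : f =ᶠ[𝓝 0] fun _ => f 0 := by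
    filter_upwards [hmax] with t ht using le_antisymm ht (hmin t)
  have h1 : f' =ᶠ[𝓝 0] fun _ => 0 := by
    have := hconst.deriv
    rw [hd] at this
    simpa using this
  have := h1.deriv_eq
  rw [hf'.deriv, deriv_const] at this
  exact hs.ne this

/-- The second derivative at `0` of the pairing along the line `(x + u t, y + v t)`. -/
lemma hessian_pairing_nonneg {x y : ℝ} (hmin : ∀ x' y', c.pairing x y ≤ c.pairing x' y')
    (u v : ℝ) : 0 ≤ u ^ 2 * S.form (deriv (deriv c.γ) x) (c.γ y)
      + 2 * u * v * S.form (deriv c.γ x) (deriv c.γ y)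
      + v ^ 2 * S.form (deriv (deriv c.γ) y) (c.γ x) := by
  have hl : ∀ z w t : ℝ, HasDerivAt (fun t => z + w * t) w t := fun z w t => by
    simpa using ((hasDerivAt_id t).const_mul w).const_add z
  have hγ : ∀ z w t : ℝ,
      HasDerivAt (fun t => c.γ (z + w * t)) (w • deriv c.γ (z + w * t)) t := fun z w t =>
    (c.hasDerivAt_γ _).scomp t (hl z w t)
  have hγ' : ∀ z w t : ℝ,
      HasDerivAt (fun t => deriv c.γ (z + w * t)) (w • deriv (deriv c.γ) (z + w * t)) t :=
    fun z w t => (c.hasDerivAt_deriv_γ _).scomp t (hl z w t)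
  have h1 : ∀ t, HasDerivAt (fun t => S.form (c.γ (x + u * t)) (c.γ (y + v * t)))
      (u * S.form (deriv c.γ (x + u * t)) (c.γ (y + v * t))
        + v * S.form (c.γ (x + u * t)) (deriv c.γ (y + v * t))) t := fun t => by
    refine (S.hasDerivAt_form (hγ x u t) (hγ y v t)).congr_deriv ?_
    simp [Model.form]; ring
  have h2 := ((S.hasDerivAt_form (hγ' x u 0) (hγ y v 0)).const_mul u).add
    ((S.hasDerivAt_form (hγ x u 0) (hγ' y v 0)).const_mul v)
  have h3 := nonneg_of_isMin h1 h2 (fun t => by simpa [pairing] using hmin (x + u * t) (y + v * t))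
  refine h3.trans_eq ?_
  simp [Model.form]; ring

/-- Distance is a decreasing function of the pairing, so the minimum is a longest chord. Its ends
are distinct, as the diagonal value `K` exceeds all others. -/
lemma exists_diameter : ∃ x, ∃ y ∈ Ioo x (x + c.P), ∀ x' y', c.pairing x y ≤ c.pairing x' y' := by
  obtain ⟨x, y, h⟩ := c.exists_pairing_le
  have hne : c.γ x ≠ c.γ y := fun e => by
    have h1 : c.pairing x y = S.curv := by rw [pairing, ← e, c.form_γ_γ]
    have h2 : c.γ 0 ≠ c.γ (c.P / 2) :=
      γ_ne_of_mem_Ioo ⟨by linarith [c.P_pos], by linarith [c.P_pos]⟩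
    have h3 := Model.lt_curv_of_mem_offDiag (pairing_mem_offDiag h2)
    linarith [h 0 (c.P / 2)]
  obtain ⟨z, hz, hzy⟩ := exists_mem_Ioo_coe_eq hne
  exact ⟨x, z, hz, fun s t => by
    rw [pairing, γ_congr hzy]; exact h s t⟩

/-- Along the two-periodic orbit of a diameter all Riccati iterates are positive. -/
lemma exists_ratio_pos : ∃ q, ∀ j, 0 < c.ratio j q := by
  obtain ⟨x, y, hy, hmin⟩ := c.exists_diameter
  have hne := γ_ne_of_mem_Ioo hy
  have hess := c.hessian_pairing_nonneg hmin
  have htx : c.tang x y = 0 :=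
    (show IsLocalMin (fun t => c.pairing t y) x from
      Eventually.of_forall fun t => hmin t y).hasDerivAt_eq_zero (c.hasDerivAt_pairing_left x y)
  have hty : c.tang y x = 0 :=
    (show IsLocalMin (fun t => c.pairing t x) y from
      Eventually.of_forall fun t => by
        change c.pairing y x ≤ c.pairing t x
        rw [c.pairing_comm y x]; exact hmin t x).hasDerivAt_eq_zero
      (c.hasDerivAt_pairing_left y x)
  have hW := chord_pos hne
  have hnx : c.nor x y = c.chord x y := by
    have := chord_sq hne
    rw [htx] at this
    exact (pow_left_inj₀ (nor_pos hne).le hW.le two_ne_zero).1 (by rw [this]; ring)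
  have hny : c.nor y x = c.chord x y := by
    have := chord_sq hne.symm
    rw [hty, c.chord_comm y x] at this
    exact (pow_left_inj₀ (nor_pos hne.symm).le hW.le two_ne_zero).1 (by rw [this]; ring)
  have hm := c.nor_mul_nor x y
  rw [← c.tang_sq_add_nor_sq x y, htx, hty, hnx, hny] at hm
  have hm1 : S.form (deriv c.γ x) (deriv c.γ y) = -1 := by
    have : c.chord x y ^ 2 * (S.form (deriv c.γ x) (deriv c.γ y) + 1) = 0 := by
      linear_combination hm
    have := (mul_eq_zero.1 this).resolve_left (by positivity)
    linarith
  set W := c.chord x y with hWdef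
  set p := S.form (deriv (deriv c.γ) x) (c.γ y) with hp
  set r := S.form (deriv (deriv c.γ) y) (c.γ x) with hr
  rw [hm1] at hess
  have hp1 := hess 1 0
  have hr1 := hess 0 1
  -- The Hessian is now `p u² - 2 u v + r v² ≥ 0`. The vector `(r, 1)` gives `r (p r - 1) ≥ 0`; the
  -- case `r = 0` is excluded by `(1, p + 1)`.
  have hpr : 1 ≤ p * r := by
    have h1 := hess r 1
    rcases (show 0 ≤ r by linarith).eq_or_lt with h0 | h0
    · have := hess 1 (p + 1)
      rw [← h0] at this
      nlinarith
    · have : 0 ≤ r * (p * r - 1) := by linarith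
      linarith [nonneg_of_mul_nonneg_right this h0]
  have hpp : 0 < p := by
    rcases (show 0 ≤ p by linarith).eq_or_lt with h0 | h0
    · rw [← h0] at hpr; linarith
    · exact h0
  have hrp : 0 < r := by
    rcases (show 0 ≤ r by linarith).eq_or_lt with h0 | h0
    · rw [← h0] at hpr; linarith
    · exact h0
  have hL₁₁x : c.L₁₁ x y = -(p / W) := by
    rw [L₁₁_eq hne, hnx, dY_L hne, hp, c.form_deriv_deriv, hnx, ← hWdef]
    change _ * (_ / W) - _ = _
    field_simp; ring
  have hL₁₁y : c.L₁₁ y x = -(r / W) := by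
    rw [L₁₁_eq hne.symm, hny, dY_L hne.symm, hr, c.form_deriv_deriv, hny, c.chord_comm y x]
    change _ * (_ / c.chord y x) - _ = _
    rw [c.chord_comm y x, ← hWdef]
    field_simp; ring
  have hL₁₂ : c.L₁₂ x y = 1 / W := by
    rw [L₁₂_eq hne, hnx, hny, ← hWdef]; field_simp
  have hL₁₂' : c.L₁₂ y x = 1 / W := by
    rw [L₁₂_eq hne.symm, hnx, hny, c.chord_comm y x, ← hWdef]; field_simp
  have z0 : (0 : ℝ) ∈ Ioo (-1 : ℝ) 1 := by norm_num
  let q₀ : ℝ × Ioo (-1 : ℝ) 1 := (x, ⟨0, z0⟩)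
  let q₁ : ℝ × Ioo (-1 : ℝ) 1 := (y, ⟨0, z0⟩)
  have hT0 : c.liftMap q₀ = q₁ := by
    have e : (c.liftMap q₀).1 = y := c.next_eq hy (by simp [cosChord, q₀, htx])
    refine Prod.ext e (Subtype.ext ?_)
    rw [liftMap_snd, e]; simp [cosChord, q₀, q₁, hty]
  have hT1 : c.proj (c.liftMap q₁) = c.proj q₀ := by
    have e : (c.liftMap q₁).1 = x + c.P := c.next_eq ⟨hy.2, by linarith [hy.1]⟩ (by
      rw [cosChord_congr rfl (c.coe_add_P x)]; simp [cosChord, q₁, hty])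
    refine Prod.ext ?_ (Subtype.ext ?_)
    · change ((c.liftMap q₁).1 : AddCircle c.P) = x
      rw [e, coe_add_P]
    · change ((c.liftMap q₁).2 : ℝ) = 0
      rw [liftMap_snd, e, cosChord_congr (c.coe_add_P x) rfl]
      simp [cosChord, q₁, htx]
  have hS1 : c.liftMap.symm q₁ = q₀ := by rw [← hT0, Equiv.symm_apply_apply]
  have hS0 : c.proj (c.liftMap.symm q₀) = c.proj q₁ := by
    rw [← proj_liftMap_symm_congr hT1, Equiv.symm_apply_apply]
  have hb0 : c.offCoeff q₀ = 1 / W := by rw [offCoeff, hT0]; exact hL₁₂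
  have hb1 : c.offCoeff q₁ = 1 / W := by
    rw [offCoeff, L₁₂_congr rfl (coe_fst_eq hT1) (c.γ_ne_liftMap _)]; exact hL₁₂'
  have hd0 : c.diagCoeff q₀ = 2 * p / W := by
    rw [diagCoeff, hT0, L₁₁_congr rfl (coe_fst_eq hS0) (c.γ_symm_ne _).symm]
    change -(c.L₁₁ x y + c.L₁₁ x y) = _
    rw [hL₁₁x]; ring
  have hd1 : c.diagCoeff q₁ = 2 * r / W := by
    rw [diagCoeff, hS1, L₁₁_congr rfl (coe_fst_eq hT1) (c.γ_ne_liftMap _)]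
    change -(c.L₁₁ y x + c.L₁₁ y x) = _
    rw [hL₁₁y]; ring
  have hsp : 0 < √p := Real.sqrt_pos.2 hpp
  have hsr : 0 < √r := Real.sqrt_pos.2 hrp
  have hsp2 : √p ^ 2 = p := Real.sq_sqrt hpp.le
  have hsr2 : √r ^ 2 = r := Real.sq_sqrt hrp.le
  have h1pr : 1 ≤ √p * √r := by
    rw [← Real.sqrt_mul hpp.le]; exact Real.one_le_sqrt.2 hpr
  have step : ∀ {s t : ℝ}, 0 < s → 0 < t → 1 ≤ s * t → s / t ≤ s ^ 2 := fun hs ht hst => by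
    rw [div_le_iff₀ ht]; nlinarith
  have hA := step hsp hsr h1pr
  have hB := step hsr hsp (by linarith [mul_comm (√p) (√r)])
  -- On this two-periodic orbit the recursion reads `r ↦ 2p - 1/r` and `r ↦ 2r - 1/r` alternately,
  -- with `p`, `r` the Hessian entries in the first terms. These bounds persist because `√p / √r ≤
  -- p` and `√r / √p ≤ r`, that is, because `p r ≥ 1`.
  have key : ∀ j, √p / √r ≤ c.ratio j q₀ ∧ √r / √p ≤ c.ratio j q₁ := by
    intro j
    induction j with
    | zero =>
      simp only [ratio, riccati, hb0, hb1, hd0, hd1]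
      have e : ∀ s : ℝ, 2 * s / W / (1 / W) = 2 * s := fun s => by field_simp
      rw [e, e]
      constructor <;> nlinarith
    | succ j ih =>
      have ih0 : 0 < c.ratio j q₀ := lt_of_lt_of_le (by positivity) ih.1
      have ih1 : 0 < c.ratio j q₁ := lt_of_lt_of_le (by positivity) ih.2
      have e : ∀ s t : ℝ, (2 * s / W - 1 / W / t) / (1 / W) = 2 * s - 1 / t := fun s t => by
        field_simp
      have e0 : c.ratio (j + 1) q₀ = 2 * p - 1 / c.ratio j q₁ := by
        have := ratio_congr j hS0
        simp only [ratio] at this ⊢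
        rw [riccati, this, offCoeff_congr hS0, hb0, hb1, hd0, e]
      have e1 : c.ratio (j + 1) q₁ = 2 * r - 1 / c.ratio j q₀ := by
        simp only [ratio]
        rw [riccati, hS1, hb0, hb1, hd1, e]
      rw [e0, e1]
      have i0 : 1 / c.ratio j q₁ ≤ √p / √r := by
        rw [← one_div_div (√r)]; exact one_div_le_one_div_of_le (by positivity) ih.2
      have i1 : 1 / c.ratio j q₀ ≤ √r / √p := by
        rw [← one_div_div (√p)]; exact one_div_le_one_div_of_le (by positivity) ih.1
      constructor <;> linarith
  exact ⟨q₀, fun j => lt_of_lt_of_le (by positivity) (key j).1⟩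

end ConvexBilliard

/-! ### The zero of an orthogonal Jacobi field with end values of opposite signs. -/

namespace Model

open Set

variable {S : Model} {ℓ α β : ℝ}

lemma contDiff_Y (S : Model) : ContDiff ℝ 2 S.Y := by
  cases S
  · exact Real.contDiff_sinh
  · exact Real.contDiff_sin

lemma Y_neg (S : Model) (t : ℝ) : S.Y (-t) = -S.Y t := by
  cases S
  · exact Real.sinh_neg t
  · exact Real.sin_neg t

/-- A point at which the Jacobi field with boundary values `α` and `-β` vanishes. -/
lemma exists_focus (hℓ : 0 < ℓ) (hY : ∀ t, 0 < t → t ≤ ℓ → 0 < S.Y t) (hα : 0 < α) (hβ : 0 < β) :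
    ∃ a ∈ Ioo 0 ℓ, α * S.Y (ℓ - a) = β * S.Y a := by
  have hcont : Continuous fun t => α * S.Y (ℓ - t) - β * S.Y t := by
    have := S.contDiff_Y.continuous
    fun_prop
  have hYℓ := hY ℓ hℓ le_rfl
  obtain ⟨a, ha, h0⟩ := intermediate_value_Ioo' hℓ.le hcont.continuousOn
    (show (0 : ℝ) ∈ Ioo _ _ by
      simp only [sub_self, sub_zero, Y_zero, mul_zero, zero_sub]
      exact ⟨neg_neg_of_pos (mul_pos hβ hYℓ), mul_pos hα hYℓ⟩)
  exact ⟨a, ha, sub_eq_zero.1 h0⟩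

section Focus

variable {a : ℝ}

lemma Y_sub_neg_iff (hY : ∀ t, 0 < t → t ≤ ℓ → 0 < S.Y t) (ha : a ∈ Ioo 0 ℓ)
    {t : ℝ} (ht : t ∈ Icc 0 ℓ) : S.Y (a - t) < 0 ↔ a < t := by
  constructor
  · intro hlt
    by_contra! hle
    rcases hle.eq_or_lt with rfl | hlt'
    · simp [Y_zero] at hlt
    · exact absurd hlt (hY _ (by linarith) (by linarith [ha.2, ht.1])).le.not_gt
  · intro hlt
    rw [← neg_sub, Y_neg]
    exact neg_neg_of_pos (hY _ (by linarith) (by linarith [ha.1, ht.2]))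

lemma Y_sub_eq_zero_iff (hY : ∀ t, 0 < t → t ≤ ℓ → 0 < S.Y t) (ha : a ∈ Ioo 0 ℓ)
    {t : ℝ} (ht : t ∈ Icc 0 ℓ) : S.Y (a - t) = 0 ↔ t = a := by
  constructor
  · intro h0
    rcases lt_trichotomy t a with hlt | heq | hlt
    · exact absurd h0 (hY _ (by linarith) (by linarith [ha.2, ht.1])).ne'
    · exact heq
    · exact absurd h0 ((Y_sub_neg_iff hY ha ht).2 hlt).ne
  · rintro rfl; simp [Y_zero]

/-- This serves the measurability of `a`: the right side involves only the data `ℓ, α, β` and the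
threshold `t`. It rests on the identity `(α Y(ℓ - t) - β Y(t)) Y(a) = α Y(ℓ) Y(a - t)`. -/
lemma focus_lt_iff (hY : ∀ t, 0 < t → t ≤ ℓ → 0 < S.Y t) (ha : a ∈ Ioo 0 ℓ)
    (h : α * S.Y (ℓ - a) = β * S.Y a)
    (hα : 0 < α) (t : ℝ) :
    a < t ↔ ℓ ≤ t ∨ 0 < t ∧ α * S.Y (ℓ - t) < β * S.Y t := by
  rcases le_or_gt ℓ t with hle | hlt
  · simp [hle, ha.2.trans_le hle]
  rcases le_or_gt t 0 with hle0 | hpos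
  · simp [hlt, hle0.not_gt, (hle0.trans ha.1.le).not_gt]
  have hYa := hY a ha.1 ha.2.le
  have hYℓ := hY ℓ (hpos.trans hlt) le_rfl
  have e : (α * S.Y (ℓ - t) - β * S.Y t) * S.Y a = α * S.Y ℓ * S.Y (a - t) := by
    rw [S.Y_sub ℓ a] at h
    rw [S.Y_sub ℓ t, S.Y_sub a t]
    linear_combination S.Y t * h
  rw [← Y_sub_neg_iff hY ha ⟨hpos.le, hlt.le⟩]
  simp only [hlt.not_ge, hpos, true_and, false_or]
  rw [← sub_neg (a := α * S.Y (ℓ - t)), ← mul_lt_mul_iff_left₀ hYa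
    (b := α * S.Y (ℓ - t) - β * S.Y t), e, zero_mul,
    ← mul_lt_mul_iff_right₀ (mul_pos hα hYℓ) (b := S.Y (a - t)), mul_zero]

lemma dY_div_Y_focus (hY : ∀ t, 0 < t → t ≤ ℓ → 0 < S.Y t) (ha : a ∈ Ioo 0 ℓ)
    (h : α * S.Y (ℓ - a) = β * S.Y a)
    (hα : 0 < α) :
    S.dY a / S.Y a = (β / α + S.dY ℓ) / S.Y ℓ := by
  have hYa := (hY a ha.1 ha.2.le).ne'
  have hYℓ := (hY ℓ (ha.1.trans ha.2) le_rfl).ne'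
  rw [S.Y_sub ℓ a] at h
  field_simp
  linear_combination h

/-- The field is `α Y(a - t) / Y(a)`; the relation defining `a` is exactly the boundary condition at
`ℓ`. -/
lemma exists_orthogonalJacobiField (hY : ∀ t, 0 < t → t ≤ ℓ → 0 < S.Y t) (ha : a ∈ Ioo 0 ℓ)
    (h : α * S.Y (ℓ - a) = β * S.Y a)
    :
    ∃ J : ℝ → ℝ, S.IsOrthogonalJacobiField J ∧ J 0 = α ∧ J ℓ = -β ∧
      (α ≠ 0 → ∀ t ∈ Icc 0 ℓ, J t = 0 ↔ t = a) := by
  have hYa := (hY a ha.1 ha.2.le).ne'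
  have h1 : ∀ t, HasDerivAt (fun t => α / S.Y a * S.Y (a - t)) (-(α / S.Y a) * S.dY (a - t)) t :=
    fun t => by
      refine (((S.hasDerivAt_Y (a - t)).comp t ((hasDerivAt_id t).const_sub a)).const_mul
        (α / S.Y a)).congr_deriv ?_
      ring
  have h2 : ∀ t, HasDerivAt (fun t => -(α / S.Y a) * S.dY (a - t))
      (-(S.curv * (α / S.Y a * S.Y (a - t)))) t := fun t => by
    refine (((S.hasDerivAt_dY (a - t)).comp t ((hasDerivAt_id t).const_sub a)).const_mul
      (-(α / S.Y a))).congr_deriv ?_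
    ring
  refine ⟨fun t => α / S.Y a * S.Y (a - t), ⟨?_, fun t => ?_⟩, ?_, ?_, fun hα t ht => ?_⟩
  · exact contDiff_const.mul (S.contDiff_Y.comp (contDiff_const.sub contDiff_id))
  · rw [show deriv (fun t => α / S.Y a * S.Y (a - t)) = fun t => -(α / S.Y a) * S.dY (a - t) from
      funext fun t => (h1 t).deriv, (h2 t).deriv]
    ring
  · simp only [sub_zero]; field_simp
  · simp only
    rw [← neg_sub, Y_neg]
    field_simp
    linear_combination -h
  · rw [mul_eq_zero, or_iff_right (div_ne_zero hα hYa), Y_sub_eq_zero_iff hY ha ht]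

end Focus

end Model

/-! ### Descent to the phase cylinder: the billiard map and the positive cocycle. -/

namespace ConvexBilliard

open Set Filter Topology

variable {S : Model} (c : ConvexBilliard S)

/-- A measurable lift of the phase cylinder to its universal cover. -/
def sect (p : c.Phase) : ℝ × Ioo (-1 : ℝ) 1 := ((AddCircle.equivIco c.P 0 p.1 : ℝ), p.2)

lemma proj_sect (p : c.Phase) : c.proj (c.sect p) = p :=
  Prod.ext ((AddCircle.equivIco c.P 0).symm_apply_apply p.1) rfl

lemma measurable_sect : Measurable c.sect :=
  (measurable_subtype_coe.comp
    ((AddCircle.measurableEquivIco c.P 0).measurable.comp measurable_fst)).prodMk measurable_snd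

lemma measurable_proj : Measurable c.proj := by
  have : Measurable fun x : ℝ => (x : AddCircle c.P) :=
    (AddCircle.continuous_mk' c.P).measurable
  exact (this.comp measurable_fst).prodMk measurable_snd

/-- The billiard map of the phase cylinder. -/
def phaseMap : c.Phase ≃ c.Phase where
  toFun p := c.proj (c.liftMap (c.sect p))
  invFun p := c.proj (c.liftMap.symm (c.sect p))
  left_inv p := by
    beta_reduce
    rw [proj_liftMap_symm_congr (c.proj_sect (c.proj (c.liftMap (c.sect p)))),
      Equiv.symm_apply_apply, proj_sect]
  right_inv p := by
    beta_reduce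
    rw [proj_liftMap_congr (c.proj_sect (c.proj (c.liftMap.symm (c.sect p)))),
      Equiv.apply_symm_apply, proj_sect]

lemma phaseMap_proj (q : ℝ × Ioo (-1 : ℝ) 1) : c.phaseMap (c.proj q) = c.proj (c.liftMap q) :=
  proj_liftMap_congr (c.proj_sect _)

lemma phaseMap_symm_proj (q : ℝ × Ioo (-1 : ℝ) 1) :
    c.phaseMap.symm (c.proj q) = c.proj (c.liftMap.symm q) :=
  proj_liftMap_symm_congr (c.proj_sect _)

lemma measurable_phaseMap : Measurable c.phaseMap :=
  c.measurable_proj.comp (c.continuous_liftMap.measurable.comp c.measurable_sect)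

lemma isBilliardMap_phaseMap : c.IsBilliardMap c.phaseMap := by
  intro x y Φ Ψ
  have hT : c.phaseMap ((x : AddCircle c.P), Φ) = c.proj (c.liftMap (x, Φ)) :=
    c.phaseMap_proj (x, Φ)
  have hne := c.γ_ne_liftMap (x, Φ)
  rw [hT]
  constructor
  · intro h
    have h1 : ((c.liftMap (x, Φ)).1 : AddCircle c.P) = y := congrArg (fun z : c.Phase => z.1) h
    have h2 : (c.liftMap (x, Φ)).2 = Ψ := congrArg (fun z : c.Phase => z.2) h
    have hxy : c.γ x ≠ c.γ y := by rw [← γ_congr h1]; exact hne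
    refine ⟨hxy, ?_, ?_⟩
    · rw [L₁_eq_cosChord hxy, neg_neg, ← cosChord_congr rfl h1]
      exact (c.cosChord_liftMap (x, Φ)).symm
    · rw [L₂_eq_L₁, L₁_eq_cosChord hxy.symm, ← h2, liftMap_snd, cosChord_congr h1 rfl]
  · rintro ⟨hxy, hΦ, hΨ⟩
    rw [L₁_eq_cosChord hxy, neg_neg] at hΦ
    rw [L₂_eq_L₁, L₁_eq_cosChord hxy.symm] at hΨ
    have h1 : ((c.liftMap (x, Φ)).1 : AddCircle c.P) = y := coe_next_eq hxy hΦ.symm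
    refine Prod.ext h1 (Subtype.ext ?_)
    change ((c.liftMap (x, Φ)).2 : ℝ) = Ψ
    rw [hΨ, liftMap_snd, cosChord_congr h1 rfl]

lemma segLength_proj (q : ℝ × Ioo (-1 : ℝ) 1) :
    c.segLength c.phaseMap (c.proj q) = c.L q.1 (c.liftMap q).1 := by
  rw [segLength, phaseMap_proj]; rfl

lemma sinAngle_proj (q : ℝ × Ioo (-1 : ℝ) 1) :
    c.sinAngle (c.proj q) = c.nor q.1 (c.liftMap q).1 / c.chord q.1 (c.liftMap q).1 := by
  rw [← sin_arccos_cosChord (c.γ_ne_liftMap q), cosChord_liftMap]; rfl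

lemma sinAngle_proj_liftMap (q : ℝ × Ioo (-1 : ℝ) 1) :
    c.sinAngle (c.proj (c.liftMap q)) =
      c.nor (c.liftMap q).1 q.1 / c.chord q.1 (c.liftMap q).1 := by
  rw [c.chord_comm q.1, ← sin_arccos_cosChord (c.γ_ne_liftMap q).symm]
  change Real.sin (Real.arccos ((c.liftMap q).2 : ℝ)) = _
  rw [liftMap_snd, Real.arccos_neg, Real.sin_pi_sub]

lemma sinAngle_pos (p : c.Phase) : 0 < c.sinAngle p := by
  rw [← c.proj_sect p, sinAngle_proj]
  exact div_pos (nor_pos (c.γ_ne_liftMap _)) (chord_pos (c.γ_ne_liftMap _))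

lemma segLength_pos (p : c.Phase) : 0 < c.segLength c.phaseMap p := by
  rw [← c.proj_sect p, segLength_proj]
  exact L_pos (c.γ_ne_liftMap _)

lemma Y_pos_of_le_segLength (p : c.Phase) (t : ℝ) (ht : 0 < t)
    (ht' : t ≤ c.segLength c.phaseMap p) : 0 < S.Y t := by
  rw [← c.proj_sect p, segLength_proj] at ht'
  exact Y_pos_of_le_L (c.γ_ne_liftMap _) ht ht'

lemma measurable_sinAngle : Measurable c.sinAngle := by
  have h : Continuous fun t : ℝ => Real.sin (Real.arccos t) :=
    Real.continuous_sin.comp Real.continuous_arccos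
  exact h.measurable.comp (measurable_subtype_coe.comp measurable_snd)

lemma measurable_segLength : Measurable (c.segLength c.phaseMap) := by
  have h : Continuous fun q : ℝ × Ioo (-1 : ℝ) 1 => c.L q.1 (c.liftMap q).1 :=
    continuous_iff_continuousAt.2 fun q =>
      ContinuousAt.comp (f := fun q : ℝ × Ioo (-1 : ℝ) 1 => (q.1, (c.liftMap q).1))
        (continuousAt_L (c.γ_ne_liftMap q))
        (continuous_fst.prodMk (continuous_fst.comp c.continuous_liftMap)).continuousAt
  have e : c.segLength c.phaseMap = (fun q => c.L q.1 (c.liftMap q).1) ∘ c.sect :=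
    funext fun p => by
      conv_lhs => rw [← c.proj_sect p, segLength_proj]
      rfl
  rw [e]
  exact h.measurable.comp c.measurable_sect

lemma offCoeff_eq (q : ℝ × Ioo (-1 : ℝ) 1) :
    c.offCoeff q = c.sinAngle (c.proj q) * c.sinAngle (c.proj (c.liftMap q))
      / S.Y (c.segLength c.phaseMap (c.proj q)) := by
  have hW := (chord_pos (c.γ_ne_liftMap q)).ne'
  rw [offCoeff, L₁₂_eq (c.γ_ne_liftMap q), sinAngle_proj, sinAngle_proj_liftMap, segLength_proj]
  change _ = _ / c.chord _ _
  field_simp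

/-- By the reflection law the incoming and outgoing chords make angles with the same sine, so a
single `sin φ` factors out of both second derivatives. -/
lemma diagCoeff_eq (q : ℝ × Ioo (-1 : ℝ) 1) :
    c.diagCoeff q = 2 * c.k q.1 * c.sinAngle (c.proj q) - c.sinAngle (c.proj q) ^ 2
      * (S.dY (c.segLength c.phaseMap (c.proj q)) / S.Y (c.segLength c.phaseMap (c.proj q))
        + S.dY (c.segLength c.phaseMap (c.proj (c.liftMap.symm q)))
          / S.Y (c.segLength c.phaseMap (c.proj (c.liftMap.symm q)))) := by
  have h1 := c.sinAngle_proj_liftMap (c.liftMap.symm q)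
  rw [Equiv.apply_symm_apply, c.chord_comm] at h1
  rw [diagCoeff, L₁₁_eq (c.γ_ne_liftMap q), L₁₁_eq (c.γ_symm_ne q).symm, segLength_proj,
    segLength_proj, ← sinAngle_proj, ← h1, Equiv.apply_symm_apply,
    c.L_comm q.1 (c.liftMap.symm q).1]
  ring

variable {c}

lemma exists_cocycle (hc : c.NoConjugatePoints) :
    ∃ ν : c.Phase → ℝ, Measurable ν ∧ (∀ p, 0 < ν p) ∧
      ∀ q, c.offCoeff q * ν (c.proj q)
        + c.offCoeff (c.liftMap.symm q) / ν (c.proj (c.liftMap.symm q)) = c.diagCoeff q := by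
  obtain ⟨q₀, hq₀⟩ := c.exists_ratio_pos
  have : PreconnectedSpace (Ioo (-1 : ℝ) 1) := isPreconnected_iff_preconnectedSpace.1
    isPreconnected_Ioo
  obtain ⟨ν, hν, hpos, heq, hlim⟩ := exists_positive_cocycle c.liftMap c.diagCoeff c.offCoeff
    c.offCoeff_pos c.continuous_offCoeff c.continuous_diagCoeff c.continuous_liftMap_symm
    (riccati_pos c.liftMap c.diagCoeff c.offCoeff c.offCoeff_pos c.continuous_offCoeff
      c.continuous_diagCoeff c.continuous_liftMap_symm (eq_zero_of_isJacobiAlong hc) hq₀)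
  -- Each iterate depends only on the projected phase point, so the limit does too and descends to
  -- the cylinder.
  have hcongr : ∀ q, ν (c.sect (c.proj q)) = ν q := fun q =>
    tendsto_nhds_unique (hlim _) ((hlim q).congr fun j => (ratio_congr j (c.proj_sect _)).symm)
  refine ⟨ν ∘ c.sect, hν.comp c.measurable_sect, fun p => hpos _, fun q => ?_⟩
  simp only [Function.comp_apply, hcongr]
  exact heq q

lemma isPositiveJacobiCocycle_of_eq {ν : c.Phase → ℝ} (hν : Measurable ν) (hpos : ∀ p, 0 < ν p)
    (heq : ∀ q, c.offCoeff q * ν (c.proj q)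
      + c.offCoeff (c.liftMap.symm q) / ν (c.proj (c.liftMap.symm q)) = c.diagCoeff q) :
    c.IsPositiveJacobiCocycle c.phaseMap ν := by
  refine ⟨hν, hpos, fun p x ξ hp hx hξ n => ?_⟩
  obtain ⟨q, hq⟩ : ∃ q, c.proj q = p n := ⟨_, c.proj_sect (p n)⟩
  have hq1 : c.proj (c.liftMap q) = p (n + 1) := by rw [← phaseMap_proj, hq, hp]
  have hq2 : c.proj (c.liftMap.symm q) = p (n - 1) := by
    rw [← phaseMap_symm_proj, hq, Equiv.symm_apply_eq, hp, sub_add_cancel]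
  have fstc : ∀ {q : ℝ × Ioo (-1 : ℝ) 1} {m : ℤ}, c.proj q = p m →
      (q.1 : AddCircle c.P) = x m := fun {q m} h => by rw [hx, ← h]; rfl
  have e0 := fstc hq
  have e1 := fstc hq1
  have e2 := fstc hq2
  have hb : c.L₁₂ (x n) (x (n + 1)) = c.offCoeff q := (L₁₂_congr e0 e1 (c.γ_ne_liftMap q)).symm
  have hb' : c.L₁₂ (x (n - 1)) (x n) = c.offCoeff (c.liftMap.symm q) := by
    rw [offCoeff, Equiv.apply_symm_apply]
    exact (L₁₂_congr e2 e0 (c.γ_symm_ne q)).symm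
  have hd : c.L₂₂ (x (n - 1)) (x n) + c.L₁₁ (x n) (x (n + 1)) = -c.diagCoeff q := by
    rw [L₂₂_eq_L₁₁, diagCoeff, neg_neg, L₁₁_congr e0 e1 (c.γ_ne_liftMap q),
      L₁₁_congr e0 e2 (c.γ_symm_ne q).symm]
  have hξ' := hξ (n - 1)
  rw [sub_add_cancel, ← hq2] at hξ'
  rw [hb, hb', hd, hξ n, ← hq, ← heq q, hξ']
  have := (hpos (c.proj (c.liftMap.symm q))).ne'
  field_simp
  ring

end ConvexBilliard

end

/-! ### The caustic distance and the mirror equation. -/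

theorem theorem4p1 (S : Model) (c : ConvexBilliard S) (hc : c.NoConjugatePoints) :
    ∃ T : c.Phase ≃ c.Phase, c.IsBilliardMap T ∧
      ∃ a : c.Phase → ℝ, Measurable a ∧
        (∀ p, 0 < a p ∧ a p < c.segLength T p) ∧
        (∀ (p : c.Phase) (x : ℝ), (x : AddCircle c.P) = p.1 →
          deriv S.Y (a p) / S.Y (a p)
            + deriv S.Y (c.segLength T (T.symm p) - a (T.symm p))
              / S.Y (c.segLength T (T.symm p) - a (T.symm p))
            = 2 * c.k x / c.sinAngle p) ∧
        c.IsCausticDistance T a := by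
  obtain ⟨ν, hν, hpos, heq⟩ := ConvexBilliard.exists_cocycle hc
  have hβpos : ∀ p, 0 < ν p * c.sinAngle (c.phaseMap p) := fun p =>
    mul_pos (hpos p) (c.sinAngle_pos _)
  choose a ha hfocus using fun p => Model.exists_focus (c.segLength_pos p)
    (c.Y_pos_of_le_segLength p) (c.sinAngle_pos p) (hβpos p)
  refine ⟨c.phaseMap, c.isBilliardMap_phaseMap, a, ?_, fun p => ha p, fun p x hx => ?_, ν,
    ConvexBilliard.isPositiveJacobiCocycle_of_eq hν hpos heq, fun p => ?_⟩
  · have hYm : Measurable S.Y := S.contDiff_Y.continuous.measurable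
    have hℓ := c.measurable_segLength
    refine measurable_of_Iio fun t => ?_
    have e : a ⁻¹' Set.Iio t = {p | c.segLength c.phaseMap p ≤ t} ∪ ({p | 0 < t} ∩
        {p | c.sinAngle p * S.Y (c.segLength c.phaseMap p - t)
          < ν p * c.sinAngle (c.phaseMap p) * S.Y t}) := by
      ext p
      exact Model.focus_lt_iff (c.Y_pos_of_le_segLength p) (ha p) (hfocus p) (c.sinAngle_pos p) t
    rw [e]
    refine (measurableSet_le hℓ measurable_const).union ((MeasurableSet.const _).inter
      (measurableSet_lt (c.measurable_sinAngle.mul (hYm.comp (hℓ.sub_const t)))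
        ((hν.mul (c.measurable_sinAngle.comp c.measurable_phaseMap)).mul_const _)))
  · obtain ⟨q, rfl⟩ : ∃ q, c.proj q = p := ⟨_, c.proj_sect p⟩
    rw [c.phaseMap_symm_proj, ConvexBilliard.k_congr (x' := q.1) hx, S.deriv_Y]
    set p' := c.proj (c.liftMap.symm q) with hp'
    have hTp' : c.phaseMap p' = c.proj q := by rw [hp', c.phaseMap_proj, Equiv.apply_symm_apply]
    have ha' := ha p'
    have h1 := Model.dY_div_Y_focus (c.Y_pos_of_le_segLength _) (ha (c.proj q))
      (hfocus (c.proj q)) (c.sinAngle_pos _)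
    -- The incoming segment is read backwards from its end point: the end values are exchanged and
    -- the caustic point lies at distance `L - a`.
    have h2 := Model.dY_div_Y_focus (a := c.segLength c.phaseMap p' - a p') (α := ν p' *
      c.sinAngle (c.phaseMap p')) (β := c.sinAngle p') (c.Y_pos_of_le_segLength p')
      ⟨by linarith [ha'.2], by linarith [ha'.1]⟩
      (by rw [sub_sub_cancel]; exact (hfocus p').symm) (hβpos p')
    have h := heq q
    rw [c.offCoeff_eq, c.offCoeff_eq, c.diagCoeff_eq, Equiv.apply_symm_apply, ← hp'] at h
    rw [h1, h2, hTp', c.phaseMap_proj]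
    have hY1 := (c.Y_pos_of_le_segLength _ _ (c.segLength_pos (c.proj q)) le_rfl).ne'
    have hY2 := (c.Y_pos_of_le_segLength _ _ (c.segLength_pos p') le_rfl).ne'
    have hs := (c.sinAngle_pos (c.proj q)).ne'
    have hν' := (hpos p').ne'
    field_simp at h ⊢
    linear_combination h
  · obtain ⟨J, hJ, hJ0, hJ1, hz⟩ := Model.exists_orthogonalJacobiField
      (c.Y_pos_of_le_segLength p) (ha p) (hfocus p)
    exact ⟨J, hJ, hJ0, hJ1, hz (c.sinAngle_pos p).ne'⟩
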